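/- Let $(\mathcal M,\mathcal H_\mu)$ and $(\mathcal N,\mathcal H_\nu)$ be von Neumann algebras with cyclic unit vectors $\xi_\mu,\xi_\nu$ and vector states $\mu(a)=\langle a\xi_\mu,\xi_\mu\rangle$, $\nu(b)=\langle b\xi_\nu,\xi_\nu\rangle$. Let $\theta_\mu,\theta_\nu$ be involutive $*$-automorphisms ($\mathbb Z_2$-gradings) of $\mathcal M,\mathcal N$ with $\mu\circ\theta_\mu=\mu$, $\nu\circ\theta_\nu=\nu$. For $\lambda\in\{\mu,\nu\}$ let $\Gamma_\lambda$ be the self-adjoint unitary on $\mathcal H_\lambda$ extending $a\xi_\lambda\mapsto\theta_\lambda(a)\xi_\lambda$, and put $\gamma_\lambda(a)=\Gamma_\lambda a\Gamma_\lambda$ and $a_\pm=\frac12(a\pm\gamma_\lambda(a))$. Define on $\mathcal B(\mathcal H_\lambda)$ the linear bijections $\kappa_\lambda(a)=a_++\Gamma_\lambda a_-$ and $\eta_\lambda(a)=a_++i\Gamma_\lambda a_-$. The twisted commutants are the von Neumann algebras $\mathcal M^\wr=\kappa_\mu(\mathcal M')$ and $\mathcal N^\wr=\kappa_\nu(\mathcal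 N')$, graded by the restrictions of $\gamma_\mu$, $\gamma_\nu$. Let $\Psi:\mathcal M\to\mathcal N$ be a positive linear map with $\Psi\circ\gamma_\mu=\gamma_\nu\circ\Psi$ on $\mathcal M$ and $\nu\circ\Psi=\mu$. Then there is a unique map $\Psi':\mathcal N'\to\mathcal M'$ with $\langle\Psi'(b')a\xi_\mu,\xi_\mu\rangle=\langle b'\Psi(a)\xi_\nu,\xi_\nu\rangle$ for all $a\in\mathcal M$, $b'\in\mathcal N'$, and it is linear. The twisted dual $\Psi^\wr:=\kappa_\mu\circ\Psi'\circ\kappa_\nu\lceil_{\mathcal N^\wr}:\mathcal N^\wr\to\mathcal M^\wr$ is positive, even (that is, $\Psi^\wr\circ\gamma_\nu=\gamma_\mu\circ\Psi^\wr$ on $\mathcal N^\wr$), bounded with $\|\Psi^\wr\|=1$, and $$\Psi^\wr=\eta_\mu\circ\Psi'\circ\eta_\nu^{-1}\lceil_{\mathcal N^\wr}=\eta_\mu^{-1}\circ\Psi'\circ\eta_\nu\lceil_{\mathcal N^\wr}.$$ In addition: (a) for every $n\in\mathbb N$, if $\Psi$ is $n$-positive, then so is $\Psi^\wr$; (b)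 if $\Psi$ is completely positive, then so is $\Psi^\wr$; (c) if $\Psi(1)=1$ and $\xi_\mu,\xi_\nu$ are separating for $\mathcal M,\mathcal N$ respectively, then $\Psi^{\wr\wr}:=(\Psi^\wr)^\wr$ (formed with the same $\Gamma_\mu,\Gamma_\nu,\xi_\mu,\xi_\nu$) is a well-defined map $\mathcal M\to\mathcal N$, and $\Psi^{\wr\wr}=\Psi$. Here well-definedness means: $\xi_\mu$ and $\xi_\nu$ are cyclic for $\mathcal M^\wr$ and $\mathcal N^\wr$, $\langle\Psi^\wr(b)\xi_\mu,\xi_\mu\rangle=\langle b\xi_\nu,\xi_\nu\rangle$ for all $b\in\mathcal N^\wr$, the dual $(\Psi^\wr)'$ exists and is unique, $(\mathcal M^\wr)^\wr=\mathcal M$ and $(\mathcal N^\wr)^\wr=\mathcal N$. -/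

import Mathlib

/-- A von Neumann algebra is closed under multiplication by complex scalars. -/
instance VonNeumannAlgebra.instSMulMemClassComplex {H : Type*} [NormedAddCommGroup H]
    [InnerProductSpace ℂ H] [CompleteSpace H] :
    SMulMemClass (VonNeumannAlgebra H) ℂ (H →L[ℂ] H) where
  smul_mem {s} r _ hx := s.toStarSubalgebra.smul_mem hx r

noncomputable section

namespace TwistedDuality

section Klein

variable {H : Type*} [NormedAddCommGroup H] [InnerProductSpace ℂ H]

/-- The adjoint action `a ↦ Γ a Γ` of a self-adjoint unitary `Γ`. -/
def ad (Γ : H →L[ℂ] H) : (H →L[ℂ] H) →ₗ[ℂ] (H →L[ℂ] H) where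
  toFun a := Γ * a * Γ
  map_add' a b := by rw [mul_add, add_mul]
  map_smul' c a := by rw [mul_smul_comm, smul_mul_assoc, RingHom.id_apply]

/-- The even part `a₊ = (a + Γ a Γ) / 2`. -/
def evenPart (Γ : H →L[ℂ] H) : (H →L[ℂ] H) →ₗ[ℂ] (H →L[ℂ] H) :=
  (1 / 2 : ℂ) • (LinearMap.id + ad Γ)

/-- The odd part `a₋ = (a - Γ a Γ) / 2`. -/
def oddPart (Γ : H →L[ℂ] H) : (H →L[ℂ] H) →ₗ[ℂ] (H →L[ℂ] H) :=
  (1 / 2 : ℂ) • (LinearMap.id - ad Γ)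

/-- The Klein transformation `κ(a₊ + a₋) = a₊ + Γ a₋`. -/
def klein (Γ : H →L[ℂ] H) : (H →L[ℂ] H) →ₗ[ℂ] (H →L[ℂ] H) :=
  evenPart Γ + LinearMap.mulLeft ℂ Γ ∘ₗ oddPart Γ

/-- The map `a₊ + a₋ ↦ a₊ + c Γ a₋`; the twist automorphism is the case `c = i`, its inverse the
case `c = -i`. -/
def twistMap (c : ℂ) (Γ : H →L[ℂ] H) : (H →L[ℂ] H) →ₗ[ℂ] (H →L[ℂ] H) :=
  evenPart Γ + c • (LinearMap.mulLeft ℂ Γ ∘ₗ oddPart Γ)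

variable {Γ : H →L[ℂ] H}

theorem mul_sq_cancel (h : Γ * Γ = 1) (a : H →L[ℂ] H) : a * Γ * Γ = a := by
  rw [mul_assoc, h, mul_one]

theorem klein_apply (Γ a : H →L[ℂ] H) :
    klein Γ a = (1 / 2 : ℂ) • (a + Γ * a * Γ) + Γ * ((1 / 2 : ℂ) • (a - Γ * a * Γ)) := rfl

theorem twistMap_apply (c : ℂ) (Γ a : H →L[ℂ] H) :
    twistMap c Γ a =
      (1 / 2 : ℂ) • (a + Γ * a * Γ) + c • (Γ * ((1 / 2 : ℂ) • (a - Γ * a * Γ))) := rfl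

theorem klein_klein (h : Γ * Γ = 1) (a : H →L[ℂ] H) : klein Γ (klein Γ a) = a := by
  simp only [klein_apply, mul_add, add_mul, mul_sub, sub_mul, smul_add, smul_sub, mul_smul_comm,
    smul_mul_assoc, ← mul_assoc, h, one_mul, mul_sq_cancel h]
  module

theorem twistMap_twistMap (h : Γ * Γ = 1) {c d : ℂ} (hcd : c * d = 1) (a : H →L[ℂ] H) :
    twistMap c Γ (twistMap d Γ a) = a := by
  simp only [twistMap_apply, mul_add, add_mul, mul_sub, sub_mul, smul_add, smul_sub, mul_smul_comm,
    smul_mul_assoc, ← mul_assoc, h, one_mul, mul_sq_cancel h, smul_smul]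
  match_scalars
  · linear_combination (1 / 2 : ℂ) * hcd
  · linear_combination (-1 / 2 : ℂ) * hcd
  · ring
  · ring

/-- The twist automorphism `η(a₊ + a₋) = a₊ + i Γ a₋`, with inverse `a₊ + a₋ ↦ a₊ - i Γ a₋`. -/
def eta (Γ : H →L[ℂ] H) (h : Γ * Γ = 1) : (H →L[ℂ] H) ≃ₗ[ℂ] (H →L[ℂ] H) where
  __ := twistMap Complex.I Γ
  invFun := twistMap (-Complex.I) Γ
  left_inv := twistMap_twistMap h (by simp)
  right_inv := twistMap_twistMap h (by simp)

theorem twistMap_I_mul (h : Γ * Γ = 1) (a b : H →L[ℂ] H) :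
    twistMap Complex.I Γ (a * b) = twistMap Complex.I Γ a * twistMap Complex.I Γ b := by
  simp only [twistMap_apply, mul_add, add_mul, mul_sub, sub_mul, smul_add, smul_sub, mul_smul_comm,
    smul_mul_assoc, ← mul_assoc, h, one_mul, mul_sq_cancel h, smul_smul]
  match_scalars <;> ring_nf <;> simp only [Complex.I_sq] <;> ring

theorem twistMap_I_star [CompleteSpace H] (h : Γ * Γ = 1) (hs : star Γ = Γ) (a : H →L[ℂ] H) :
    star (twistMap Complex.I Γ a) = twistMap Complex.I Γ (star a) := by
  simp only [twistMap_apply, star_add, star_sub, star_smul, star_mul, hs, mul_sub,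
    smul_add, smul_sub, mul_smul_comm, ← mul_assoc, h, one_mul, smul_smul]
  match_scalars <;> simp [mul_comm]

theorem twistMap_klein (h : Γ * Γ = 1) (c : ℂ) (a : H →L[ℂ] H) :
    twistMap c Γ (klein Γ a) = ((1 + c) / 2) • a + ((1 - c) / 2) • (Γ * a * Γ) := by
  simp only [klein_apply, twistMap_apply, mul_add, add_mul, mul_sub, sub_mul, smul_add, smul_sub,
    mul_smul_comm, smul_mul_assoc, ← mul_assoc, h, one_mul, mul_sq_cancel h, smul_smul]
  module

theorem klein_twistMap (h : Γ * Γ = 1) (c : ℂ) (a : H →L[ℂ] H) :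
    klein Γ (twistMap c Γ a) = ((1 + c) / 2) • a + ((1 - c) / 2) • (Γ * a * Γ) := by
  simp only [klein_apply, twistMap_apply, mul_add, add_mul, mul_sub, sub_mul, smul_add, smul_sub,
    mul_smul_comm, smul_mul_assoc, ← mul_assoc, h, one_mul, mul_sq_cancel h, smul_smul]
  module

end Klein

/-- A von Neumann algebra on `H` together with a self-adjoint unitary `Γ` whose adjoint action
leaves the algebra globally stable, and a vector `ξ` fixed by `Γ`. -/
structure SpatialGradedVN (H : Type*) [NormedAddCommGroup H] [InnerProductSpace ℂ H]
    [CompleteSpace H] where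
  alg : VonNeumannAlgebra H
  Γ : H →L[ℂ] H
  ξ : H
  star_Γ : star Γ = Γ
  Γ_mul_Γ : Γ * Γ = 1
  Γ_ξ : Γ ξ = ξ
  stable : ∀ a ∈ alg, Γ * a * Γ ∈ alg

/-- A von Neumann algebra `(alg, H)` with a `ℤ₂`-grading, given by an involutive `*`-automorphism
`θ`, and a cyclic unit vector `ξ` whose vector state `a ↦ ⟨a ξ, ξ⟩` on the algebra is even. -/
structure GradedVN (H : Type*) [NormedAddCommGroup H] [InnerProductSpace ℂ H]
    [CompleteSpace H] where
  alg : VonNeumannAlgebra H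
  θ : alg ≃⋆ₐ[ℂ] alg
  θ_θ : ∀ a, θ (θ a) = a
  ξ : H
  norm_ξ : ‖ξ‖ = 1
  cyclic : DenseRange fun a : alg => (a : H →L[ℂ] H) ξ
  even : ∀ a : alg, inner ℂ ξ ((θ a : H →L[ℂ] H) ξ) = inner ℂ ξ ((a : H →L[ℂ] H) ξ)

section Spatial

variable {H : Type*} [NormedAddCommGroup H] [InnerProductSpace ℂ H] [CompleteSpace H]

namespace GradedVN

/-- The map `a ↦ a ξ`. -/
def orbit (A : GradedVN H) : A.alg →ₗ[ℂ] H where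
  toFun a := (a : H →L[ℂ] H) A.ξ
  map_add' _ _ := rfl
  map_smul' _ _ := rfl

/-- The self-adjoint unitary implementing the grading: the continuous extension to `H` of
`a ξ ↦ θ(a) ξ`, `a ∈ alg`. -/
def Γ (A : GradedVN H) : H →L[ℂ] H :=
  (A.orbit ∘ₗ (A.θ : A.alg →ₗ[ℂ] A.alg)).extendOfNorm A.orbit

theorem inner_orbit (A : GradedVN H) (a b : A.alg) :
    inner ℂ ((a : H →L[ℂ] H) A.ξ) ((b : H →L[ℂ] H) A.ξ)
      = inner ℂ A.ξ (((star a * b : A.alg) : H →L[ℂ] H) A.ξ) := by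
  change _ = inner ℂ A.ξ (ContinuousLinearMap.adjoint (a : H →L[ℂ] H) ((b : H →L[ℂ] H) A.ξ))
  rw [ContinuousLinearMap.adjoint_inner_right]

theorem norm_orbit_θ (A : GradedVN H) (a : A.alg) : ‖A.orbit (A.θ a)‖ = ‖A.orbit a‖ := by
  have h : inner ℂ (A.orbit (A.θ a)) (A.orbit (A.θ a)) = inner ℂ (A.orbit a) (A.orbit a) := by
    refine (A.inner_orbit _ _).trans (Eq.trans ?_ (A.inner_orbit _ _).symm)
    rw [← A.even (star a * a), map_mul, map_star]
  rw [inner_self_eq_norm_sq_to_K, inner_self_eq_norm_sq_to_K] at h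
  have h' : ‖A.orbit (A.θ a)‖ ^ 2 = ‖A.orbit a‖ ^ 2 := by exact_mod_cast h
  exact (sq_eq_sq₀ (norm_nonneg _) (norm_nonneg _)).mp h'

theorem Γ_orbit (A : GradedVN H) (a : A.alg) :
    A.Γ ((a : H →L[ℂ] H) A.ξ) = (A.θ a : H →L[ℂ] H) A.ξ :=
  LinearMap.extendOfNorm_eq (f := A.orbit ∘ₗ (A.θ : A.alg →ₗ[ℂ] A.alg)) (e := A.orbit)
    A.cyclic ⟨1, fun x => by rw [one_mul]; exact (A.norm_orbit_θ x).le⟩ a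

theorem ext_orbit (A : GradedVN H) {S T : H →L[ℂ] H}
    (h : ∀ a : A.alg, S ((a : H →L[ℂ] H) A.ξ) = T ((a : H →L[ℂ] H) A.ξ)) : S = T :=
  ContinuousLinearMap.ext fun x =>
    congrFun (A.cyclic.equalizer S.continuous T.continuous (funext h)) x

theorem Γ_mul_Γ (A : GradedVN H) : A.Γ * A.Γ = 1 :=
  A.ext_orbit fun a => by
    rw [mul_apply_eq_comp, Γ_orbit, Γ_orbit, θ_θ, one_apply_eq_self]

/-- The adjoint action of `Γ` extends the grading `θ`. -/
theorem Γ_mul_mul_Γ (A : GradedVN H) (a : A.alg) :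
    A.Γ * (a : H →L[ℂ] H) * A.Γ = (A.θ a : H →L[ℂ] H) :=
  A.ext_orbit fun b => by
    rw [mul_apply_eq_comp, Γ_orbit, mul_apply_eq_comp]
    change A.Γ (((a * A.θ b : A.alg) : H →L[ℂ] H) A.ξ) = _
    rw [Γ_orbit, map_mul, θ_θ]
    rfl

theorem star_Γ (A : GradedVN H) : star A.Γ = A.Γ := by
  refine A.ext_orbit fun b => A.cyclic.eq_of_inner_right (𝕜 := ℂ) fun a => ?_
  rw [ContinuousLinearMap.star_eq_adjoint, ContinuousLinearMap.adjoint_inner_right, Γ_orbit,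
    Γ_orbit, inner_orbit, inner_orbit, ← A.even, map_mul, map_star, θ_θ]

/-- The spatial form of a graded von Neumann algebra with cyclic vector and even vector state. -/
abbrev toSpatial (A : GradedVN H) : SpatialGradedVN H where
  alg := A.alg
  Γ := A.Γ
  ξ := A.ξ
  star_Γ := A.star_Γ
  Γ_mul_Γ := A.Γ_mul_Γ
  Γ_ξ := by simpa using A.Γ_orbit 1
  stable a ha := by
    rw [A.Γ_mul_mul_Γ ⟨a, ha⟩]
    exact (A.θ ⟨a, ha⟩).2

end GradedVN

namespace SpatialGradedVN

variable (A : SpatialGradedVN H)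

/-- The grading `a ↦ Γ a Γ` of the algebra. -/
def γ : A.alg →ₗ[ℂ] A.alg where
  toFun a := ⟨ad A.Γ a, A.stable a a.2⟩
  map_add' _ _ := Subtype.ext (map_add (ad A.Γ) _ _)
  map_smul' _ _ := Subtype.ext (map_smul (ad A.Γ) _ _)

/-- The Klein transformation of `B(H)`. -/
abbrev κ : (H →L[ℂ] H) →ₗ[ℂ] (H →L[ℂ] H) := klein A.Γ

/-- The twist automorphism of `B(H)`. -/
abbrev η : (H →L[ℂ] H) ≃ₗ[ℂ] (H →L[ℂ] H) := eta A.Γ A.Γ_mul_Γ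

theorem stable_commutant {x : H →L[ℂ] H} (hx : x ∈ A.alg.commutant) :
    A.Γ * x * A.Γ ∈ A.alg.commutant := by
  rw [VonNeumannAlgebra.mem_commutant_iff] at hx ⊢
  intro g hg
  have h1 := hx _ (A.stable g hg)
  calc g * (A.Γ * x * A.Γ) = A.Γ * ((A.Γ * g * A.Γ) * x) * A.Γ := by
        simp only [← mul_assoc, A.Γ_mul_Γ, one_mul]
    _ = A.Γ * (x * (A.Γ * g * A.Γ)) * A.Γ := by rw [h1]
    _ = A.Γ * x * A.Γ * g := by
        simp only [← mul_assoc, mul_sq_cancel A.Γ_mul_Γ]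

theorem image_klein_commutant :
    A.κ '' (A.alg.commutant : Set (H →L[ℂ] H)) =
      Set.centralizer (A.η '' (A.alg : Set (H →L[ℂ] H))) := by
  have hΓ := A.Γ_mul_Γ
  have hcomb : ∀ (c d : ℂ) (y : H →L[ℂ] H), y ∈ A.alg.commutant →
      c • y + d • (A.Γ * y * A.Γ) ∈ A.alg.commutant := fun c d y hy =>
    add_mem (SMulMemClass.smul_mem c hy) (SMulMemClass.smul_mem d (A.stable_commutant hy))
  have hinv : ∀ x, twistMap Complex.I A.Γ (twistMap (-Complex.I) A.Γ x) = x :=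
    twistMap_twistMap hΓ (by simp)
  have hinv' : ∀ x, twistMap (-Complex.I) A.Γ (twistMap Complex.I A.Γ x) = x :=
    twistMap_twistMap hΓ (by simp)
  ext x
  constructor
  · rintro ⟨y, hy, rfl⟩
    rintro _ ⟨a, ha, rfl⟩
    have hz : twistMap (-Complex.I) A.Γ (A.κ y) ∈ A.alg.commutant := by
      rw [twistMap_klein hΓ]; exact hcomb _ _ _ hy
    have hc := VonNeumannAlgebra.mem_commutant_iff.mp hz a ha
    have hc' := congrArg (twistMap Complex.I A.Γ) hc
    rwa [twistMap_I_mul hΓ, twistMap_I_mul hΓ, hinv] at hc'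
  · intro hx
    have hz : twistMap (-Complex.I) A.Γ x ∈ A.alg.commutant := by
      rw [VonNeumannAlgebra.mem_commutant_iff]
      intro a ha
      have hc := hx _ ⟨a, ha, rfl⟩
      change twistMap Complex.I A.Γ a * x = x * twistMap Complex.I A.Γ a at hc
      rw [← hinv x, ← twistMap_I_mul hΓ, ← twistMap_I_mul hΓ] at hc
      have hc' := congrArg (twistMap (-Complex.I) A.Γ) hc
      rwa [hinv', hinv'] at hc'
    refine ⟨A.κ x, ?_, klein_klein hΓ x⟩
    have := hcomb ((1 + Complex.I) / 2) ((1 - Complex.I) / 2) _ hz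
    rw [← klein_twistMap hΓ, hinv] at this
    exact this

/-- The twisted commutant `κ(alg')`, as a von Neumann algebra. -/
def twistedCommutant : VonNeumannAlgebra H where
  carrier := A.κ '' (A.alg.commutant : Set (H →L[ℂ] H))
  mul_mem' {a b} ha hb := by
    rw [image_klein_commutant] at *; exact Set.mul_mem_centralizer ha hb
  one_mem' := by rw [image_klein_commutant]; exact Set.one_mem_centralizer
  add_mem' {a b} ha hb := by
    rw [image_klein_commutant] at *; exact Set.add_mem_centralizer ha hb
  zero_mem' := by rw [image_klein_commutant]; exact Set.zero_mem_centralizer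
  algebraMap_mem' r := by
    rw [image_klein_commutant]; exact fun a _ => (Algebra.commutes r a).symm
  star_mem' {a} ha := by
    rw [image_klein_commutant] at *
    rintro _ ⟨b, hb, rfl⟩
    have h := ha _ ⟨star b, star_mem hb, rfl⟩
    have h' : star (A.η (star b)) = A.η b := by
      change star (twistMap Complex.I A.Γ (star b)) = twistMap Complex.I A.Γ b
      rw [twistMap_I_star A.Γ_mul_Γ A.star_Γ, star_star]
    have h2 := congrArg star h
    rw [star_mul, star_mul, h'] at h2
    exact h2.symm
  centralizer_centralizer' := by
    rw [image_klein_commutant, Set.centralizer_centralizer_centralizer]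

/-- The twisted commutant, with the same `Γ` and the same vector. -/
def twist : SpatialGradedVN H where
  alg := A.twistedCommutant
  Γ := A.Γ
  ξ := A.ξ
  star_Γ := A.star_Γ
  Γ_mul_Γ := A.Γ_mul_Γ
  Γ_ξ := A.Γ_ξ
  stable := by
    rintro _ ⟨y, hy, rfl⟩
    refine ⟨A.Γ * y * A.Γ, A.stable_commutant hy, ?_⟩
    simp only [klein_apply, mul_add, add_mul, mul_sub, sub_mul, mul_smul_comm, smul_mul_assoc,
      ← mul_assoc, A.Γ_mul_Γ, one_mul, mul_sq_cancel A.Γ_mul_Γ]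

theorem κ_mem_commutant {b : H →L[ℂ] H} (hb : b ∈ A.twist.alg) : A.κ b ∈ A.alg.commutant := by
  obtain ⟨y, hy, rfl⟩ := hb
  rw [klein_klein A.Γ_mul_Γ]
  exact hy

/-- The Klein transformation as a map from the twisted commutant to the commutant. -/
def κToCommutant : A.twist.alg →ₗ[ℂ] A.alg.commutant where
  toFun b := ⟨A.κ b, A.κ_mem_commutant b.2⟩
  map_add' _ _ := Subtype.ext (map_add A.κ _ _)
  map_smul' _ _ := Subtype.ext (map_smul A.κ _ _)

/-- The Klein transformation as a map from the commutant to the twisted commutant. -/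
def κToTwist : A.alg.commutant →ₗ[ℂ] A.twist.alg where
  toFun b := ⟨A.κ b, b, b.2, rfl⟩
  map_add' _ _ := Subtype.ext (map_add A.κ _ _)
  map_smul' _ _ := Subtype.ext (map_smul A.κ _ _)

/-- The vector functional `a ↦ ⟨a ξ, ξ⟩` on `B(H)` (linear in `a`). -/
def ω (a : H →L[ℂ] H) : ℂ := inner ℂ A.ξ (a A.ξ)

/-- The vector `ξ` is cyclic for the algebra. -/
def IsCyclic : Prop := DenseRange fun a : A.alg => (a : H →L[ℂ] H) A.ξ

/-- The vector `ξ` is separating for the algebra. -/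
def IsSeparating : Prop := ∀ a ∈ A.alg, a A.ξ = 0 → a = 0

end SpatialGradedVN

end Spatial

section Maps

variable {H K : Type*} [NormedAddCommGroup H] [InnerProductSpace ℂ H] [CompleteSpace H]
  [NormedAddCommGroup K] [InnerProductSpace ℂ K] [CompleteSpace K]

/-- A linear map between von Neumann algebras is positive if it maps positive operators to
positive operators. -/
def IsPositiveMap {M : VonNeumannAlgebra H} {N : VonNeumannAlgebra K} (Ψ : M →ₗ[ℂ] N) : Prop :=
  ∀ a : M, 0 ≤ (a : H →L[ℂ] H) → 0 ≤ (Ψ a : K →L[ℂ] K)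

/-- A linear map `Ψ : M → N` between von Neumann algebras is `n`-positive if its entrywise
application maps positive elements of the matrix algebra `Mₙ(M) ⊆ Mₙ(B(H))` to positive elements of
`Mₙ(N) ⊆ Mₙ(B(K))`. -/
def IsNPositive {M : VonNeumannAlgebra H} {N : VonNeumannAlgebra K} (n : ℕ) (Ψ : M →ₗ[ℂ] N) :
    Prop :=
  ∀ a : Matrix (Fin n) (Fin n) M,
    0 ≤ CStarMatrix.ofMatrix (a.map fun x => (x : H →L[ℂ] H)) →
      0 ≤ CStarMatrix.ofMatrix (a.map fun x => (Ψ x : K →L[ℂ] K))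

/-- A linear map is completely positive if it is `n`-positive for all `n`. -/
def IsCompletelyPositive {M : VonNeumannAlgebra H} {N : VonNeumannAlgebra K} (Ψ : M →ₗ[ℂ] N) :
    Prop :=
  ∀ n : ℕ, IsNPositive n Ψ

/-- A linear map is even if it intertwines the gradings. -/
def IsEven (A : SpatialGradedVN H) (B : SpatialGradedVN K) (Ψ : A.alg →ₗ[ℂ] B.alg) : Prop :=
  ∀ a, Ψ (A.γ a) = B.γ (Ψ a)

/-- A linear map preserves the vector functionals: `ω_B ∘ Ψ = ω_A`. -/
def PreservesState (A : SpatialGradedVN H) (B : SpatialGradedVN K) (Ψ : A.alg →ₗ[ℂ] B.alg) :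
    Prop :=
  ∀ a, B.ω (Ψ a) = A.ω a

/-- The defining relation `⟨Ψ'(b') a ξ, ξ⟩ = ⟨b' Ψ(a) ξ, ξ⟩` of the dual `Ψ'` of `Ψ`. -/
def IsDual (A : SpatialGradedVN H) (B : SpatialGradedVN K) (Ψ : A.alg →ₗ[ℂ] B.alg)
    (Ψ' : B.alg.commutant → A.alg.commutant) : Prop :=
  ∀ (b : B.alg.commutant) (a : A.alg),
    A.ω ((Ψ' b : H →L[ℂ] H) * a) = B.ω ((b : K →L[ℂ] K) * Ψ a)

open Classical in
/-- The dual `Ψ' : N' → M'` of `Ψ : M → N`, the linear map determined by `IsDual`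
(and `0` if there is no such map). -/
def dual (A : SpatialGradedVN H) (B : SpatialGradedVN K) (Ψ : A.alg →ₗ[ℂ] B.alg) :
    B.alg.commutant →ₗ[ℂ] A.alg.commutant :=
  if h : ∃ Ψ' : B.alg.commutant →ₗ[ℂ] A.alg.commutant, IsDual A B Ψ Ψ' then h.choose else 0

/-- The dual of `Ψ` is well defined: `dual A B Ψ` satisfies the defining relation, and it is the
only map that does. -/
def HasDual (A : SpatialGradedVN H) (B : SpatialGradedVN K) (Ψ : A.alg →ₗ[ℂ] B.alg) : Prop :=
  IsDual A B Ψ (dual A B Ψ) ∧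
    ∀ Φ : B.alg.commutant → A.alg.commutant, IsDual A B Ψ Φ → Φ = dual A B Ψ

/-- The twisted dual `κ ∘ Ψ' ∘ κ`, a map from the twisted commutant of the codomain of `Ψ` to the
twisted commutant of its domain. -/
def twistedDual (A : SpatialGradedVN H) (B : SpatialGradedVN K) (Ψ : A.alg →ₗ[ℂ] B.alg) :
    B.twist.alg →ₗ[ℂ] A.twist.alg :=
  A.κToTwist ∘ₗ dual A B Ψ ∘ₗ B.κToCommutant

end Maps

end TwistedDuality

end

/-! For `b ≥ 0` in `N'`, the functional `a ↦ ω(b Ψ(a))` is positive, since `b` commutes with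
`Ψ(a⋆a)`, and it is dominated by `‖b‖ μ`. Cauchy–Schwarz turns it into a bounded form on `Mξ`, hence
into an operator in `M'` (`exists_mem_commutant`). Linear combinations give `Ψ'`; cyclicity gives
uniqueness and linearity. Positivity and `n`-positivity of `Ψ'` are tested on the dense set of
vectors `aξ` (`dual_isNPositive`).

The Klein map `κ` does not preserve positivity in general, but `η` is a `*`-automorphism. Both `η κ`
and `η⁻¹ κ` are scalar combinations of the identity and the grading, and `Ψ'` commutes with the
gradings because `Ψ` is even. So `κ` may be replaced by `η` (`twistedDual_eq_twistMap`), and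
positivity passes to the twisted dual. State preservation makes the twisted dual unital, and unital
positive maps are contractive (`norm_map_le_of_positive_of_unital`, Russo–Dye).

For the bidual, `κ` carries `M` onto the commutant of the twisted commutant, and `ω(κ(a) κ(z)) =
ω(γ(a) z)` reduces the relation defining the second dual to the one defining `Ψ'`. Separating
vectors supply the cyclicity that is needed. -/

/-! ### Contractivity of unital positive maps (Russo–Dye). -/

theorem IsPrimitiveRoot.sum_pow_mul_conj_pow {m : ℕ} {ζ : ℂ} (hζ : IsPrimitiveRoot ζ m)
    {k l : ℕ} (hk : k < m) (hl : l < m) :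
    ∑ j ∈ Finset.range m, (ζ ^ j) ^ k * star (ζ ^ j) ^ l = if k = l then (m : ℂ) else 0 := by
  have hm : m ≠ 0 := by omega
  have hn : ‖ζ‖ = 1 := hζ.norm'_eq_one hm
  have h1 : star ζ * ζ = 1 := by
    rw [Complex.star_def, Complex.conj_mul', hn]; simp
  have h2 : ζ * star ζ = 1 := by rw [mul_comm, h1]
  have hterm : ∀ j, (ζ ^ j) ^ k * star (ζ ^ j) ^ l = (ζ ^ k * star ζ ^ l) ^ j := fun j => by
    rw [star_pow, mul_pow, ← pow_mul, ← pow_mul, ← pow_mul, ← pow_mul, mul_comm j k, mul_comm j l]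
  simp_rw [hterm]
  split_ifs with h
  · subst h
    simp only [← mul_pow, h2, one_pow, Finset.sum_const, Finset.card_range, nsmul_eq_mul, mul_one]
  -- As `k, l < m`, the ratio is an `m`-th root of unity other than `1`, so its geometric sum
  -- vanishes.
  · have hne : ζ ^ k * star ζ ^ l ≠ 1 := fun h' => h <| hζ.pow_inj hk hl <| by
      calc ζ ^ k = (ζ ^ k * star ζ ^ l) * ζ ^ l := by
            rw [mul_assoc, ← mul_pow, h1, one_pow, mul_one]
        _ = ζ ^ l := by rw [h', one_mul]
    have hpow : (ζ ^ k * star ζ ^ l) ^ m = 1 := by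
      rw [mul_pow, ← pow_mul, ← pow_mul, mul_comm k, mul_comm l, pow_mul, pow_mul, ← star_pow,
        hζ.pow_eq_one]
      simp
    rw [geom_sum_eq hne, hpow, sub_self, zero_div]

namespace ContinuousLinearMap

variable {H : Type*} [NormedAddCommGroup H] [InnerProductSpace ℂ H] [CompleteSpace H]

/-- A combination of a positive resolution of the identity with coefficients in the unit disc is a
contraction. -/
theorem norm_sum_smul_le_one {ι : Type*} (s : Finset ι) (P : ι → H →L[ℂ] H) (c : ι → ℂ)
    (hP : ∀ i ∈ s, 0 ≤ P i) (hsum : ∑ i ∈ s, P i = 1) (hc : ∀ i ∈ s, ‖c i‖ ≤ 1) :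
    ‖∑ i ∈ s, c i • P i‖ ≤ 1 := by
  refine opNorm_le_bound _ zero_le_one fun x => ?_
  rw [one_mul]
  set y := (∑ i ∈ s, c i • P i) x with hy
  -- With `q i` the square root of `P i`, the sum of `‖q i z‖²` is `‖z‖²`. Cauchy–Schwarz and AM–GM
  -- then give `‖y‖² ≤ (‖y‖² + ‖x‖²) / 2`.
  let q : ι → H →L[ℂ] H := fun i => CFC.sqrt (P i)
  have hq : ∀ i ∈ s, ∀ z w, inner ℂ z (P i w) = inner ℂ (q i z) (q i w) := fun i hi z w => by
    have h1 : P i = q i * q i := (CFC.sqrt_mul_sqrt_self (P i) (hP i hi)).symm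
    have h2 : adjoint (q i) = q i := (CFC.sqrt_nonneg (P i)).isSelfAdjoint
    rw [h1, mul_apply_eq_comp, ← adjoint_inner_left, h2]
  have hnorm : ∀ z, ∑ i ∈ s, ‖q i z‖ ^ 2 = ‖z‖ ^ 2 := fun z => by
    have h1 : inner ℂ z ((∑ i ∈ s, P i) z) = inner ℂ z z := by rw [hsum]; rfl
    rw [sum_apply, inner_sum, Finset.sum_congr rfl fun i hi => hq i hi z z] at h1
    simp only [inner_self_eq_norm_sq_to_K] at h1
    exact_mod_cast h1
  have h1 : ‖y‖ ^ 2 ≤ ∑ i ∈ s, ‖q i y‖ * ‖q i x‖ := by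
    have h2 : inner ℂ y y = ∑ i ∈ s, c i * inner ℂ (q i y) (q i x) := by
      conv_lhs => arg 3; rw [hy, sum_apply]
      rw [inner_sum]
      refine Finset.sum_congr rfl fun i hi => ?_
      rw [smul_apply, inner_smul_right, hq i hi]
    have h3 : ‖y‖ ^ 2 = ‖inner ℂ y y‖ := by
      rw [inner_self_eq_norm_sq_to_K]; simp
    rw [h3, h2]
    refine (norm_sum_le _ _).trans (Finset.sum_le_sum fun i hi => ?_)
    rw [norm_mul]
    exact (mul_le_of_le_one_left (norm_nonneg _) (hc i hi)).trans (norm_inner_le_norm _ _)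
  have h2 : ∑ i ∈ s, ‖q i y‖ * ‖q i x‖ ≤ ∑ i ∈ s, (‖q i y‖ ^ 2 + ‖q i x‖ ^ 2) / 2 :=
    Finset.sum_le_sum fun i _ => by nlinarith [sq_nonneg (‖q i y‖ - ‖q i x‖)]
  rw [← Finset.sum_div, Finset.sum_add_distrib, hnorm, hnorm] at h2
  exact (sq_le_sq₀ (norm_nonneg _) (norm_nonneg _)).mp (by linarith)

end ContinuousLinearMap

section RussoDye

variable {A : Type*} [CStarAlgebra A]
  {H : Type*} [NormedAddCommGroup H] [InnerProductSpace ℂ H] [CompleteSpace H]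

/-- A discrete Fejér kernel in `u` yields positive elements whose plain sum is a multiple of `1` and
whose sum weighted by roots of unity is a multiple of `u`. Their images form a positive resolution
of the identity, so `(n / (n + 1)) Φ u` is a contraction for every `n`. -/
theorem norm_map_unitary_le_one (Φ : A →ₗ[ℂ] (H →L[ℂ] H)) (hpos : ∀ a, 0 ≤ Φ (star a * a))
    (hone : Φ 1 = 1) {u : A} (hu : u ∈ unitary A) : ‖Φ u‖ ≤ 1 := by
  have key : ∀ n : ℕ, (n : ℝ) * ‖Φ u‖ ≤ n + 1 := by
    intro n
    set N := n + 1 with hN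
    -- The exponents `k + c` with `k < N`, `c ≤ 1` reach `N`; a root of order `N + 1` avoids
    -- wrap-around.
    set m := N + 1 with hm
    have hm0 : (m : ℂ) ≠ 0 := by rw [hm]; exact Nat.cast_ne_zero.mpr (Nat.succ_ne_zero N)
    have hN0 : (N : ℂ) ≠ 0 := by rw [hN]; exact Nat.cast_ne_zero.mpr (Nat.succ_ne_zero n)
    obtain ⟨ζ, hζ⟩ : ∃ ζ : ℂ, IsPrimitiveRoot ζ m :=
      ⟨_, Complex.isPrimitiveRoot_exp m (Nat.succ_ne_zero _)⟩
    have hn : ‖ζ‖ = 1 := hζ.norm'_eq_one (Nat.succ_ne_zero _)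
    let w : ℕ → A := fun j => ∑ k ∈ Finset.range N, star (ζ ^ j) ^ k • u ^ k
    have hw : ∀ j, star (w j) * w j = ∑ k ∈ Finset.range N, ∑ l ∈ Finset.range N,
        ((ζ ^ j) ^ k * star (ζ ^ j) ^ l) • (star u ^ k * u ^ l) := fun j => by
      simp only [w, star_sum, star_smul, star_pow, star_star, Finset.sum_mul_sum,
        smul_mul_smul_comm]
    have hsum : ∀ c : ℕ, c ≤ 1 → ∑ j ∈ Finset.range m, (ζ ^ j) ^ c • (star (w j) * w j) =
        ∑ k ∈ Finset.range N, ∑ l ∈ Finset.range N,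
          (if k + c = l then (m : ℂ) else 0) • (star u ^ k * u ^ l) := fun c hc => by
      simp only [hw, Finset.smul_sum, smul_smul, ← mul_assoc, ← pow_add]
      rw [Finset.sum_comm]
      refine Finset.sum_congr rfl fun k hk => ?_
      rw [Finset.sum_comm]
      refine Finset.sum_congr rfl fun l hl => ?_
      rw [Finset.mem_range] at hk hl
      rw [← Finset.sum_smul, ← hζ.sum_pow_mul_conj_pow (by omega) (by omega), add_comm c k]
    have huu : ∀ k, star u ^ k * u ^ k = 1 := fun k => by
      rw [← star_pow]; exact (Unitary.mem_iff.mp (pow_mem hu k)).1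
    have hsum0 : ∑ j ∈ Finset.range m, star (w j) * w j = ((m : ℂ) * N) • (1 : A) := by
      have := hsum 0 zero_le_one
      simp only [pow_zero, one_smul, add_zero] at this
      rw [this]
      have : ∀ k ∈ Finset.range N, ∑ l ∈ Finset.range N,
          (if k = l then (m : ℂ) else 0) • (star u ^ k * u ^ l) = (m : ℂ) • (1 : A) :=
        fun k hk => by
          simp only [ite_smul, zero_smul]
          rw [Finset.sum_ite_eq, if_pos hk, huu]
      rw [Finset.sum_congr rfl this, Finset.sum_const, Finset.card_range,
        ← Nat.cast_smul_eq_nsmul ℂ, smul_smul, mul_comm]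
    -- The shifted diagonal `l = k + 1` has only `n = N - 1` entries in range, whence `n` in place
    -- of `N`.
    have hsum1 : ∑ j ∈ Finset.range m, ζ ^ j • (star (w j) * w j) = ((m : ℂ) * n) • u := by
      have := hsum 1 le_rfl
      simp only [pow_one] at this
      rw [this, hN, Finset.sum_range_succ]
      have h1 : ∀ k ∈ Finset.range n, ∑ l ∈ Finset.range (n + 1),
          (if k + 1 = l then (m : ℂ) else 0) • (star u ^ k * u ^ l) = (m : ℂ) • u :=
        fun k hk => by
          simp only [ite_smul, zero_smul]
          rw [Finset.sum_ite_eq, if_pos (by rw [Finset.mem_range] at *; omega), pow_succ,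
            ← mul_assoc, huu, one_mul]
      have h2 : ∑ l ∈ Finset.range (n + 1),
          (if n + 1 = l then (m : ℂ) else 0) • (star u ^ n * u ^ l) = 0 := by
        simp only [ite_smul, zero_smul]
        rw [Finset.sum_ite_eq, if_neg (by simp)]
      rw [Finset.sum_congr rfl h1, h2, add_zero, Finset.sum_const, Finset.card_range,
        ← Nat.cast_smul_eq_nsmul ℂ, smul_smul, mul_comm]
    have hr : (((m : ℝ) * N)⁻¹ : ℝ) = ((m : ℂ) * N)⁻¹ := by push_cast; rfl
    let P : ℕ → H →L[ℂ] H := fun j => ((m : ℂ) * N)⁻¹ • Φ (star (w j) * w j)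
    have hP : ∀ j ∈ Finset.range m, 0 ≤ P j := fun j _ => by
      have : P j = ((m : ℝ) * N)⁻¹ • Φ (star (w j) * w j) := by
        rw [← Complex.coe_smul, hr]
      rw [this]
      exact smul_nonneg (by positivity) (hpos _)
    have hP1 : ∑ j ∈ Finset.range m, P j = 1 := by
      rw [← Finset.smul_sum, ← map_sum, hsum0, map_smul, hone, smul_smul,
        inv_mul_cancel₀ (mul_ne_zero hm0 hN0), one_smul]
    have hPu : ∑ j ∈ Finset.range m, ζ ^ j • P j = ((n : ℂ) / N) • Φ u := by
      have : ∀ j ∈ Finset.range m,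
          ζ ^ j • P j = ((m : ℂ) * N)⁻¹ • Φ (ζ ^ j • (star (w j) * w j)) := fun j _ => by
        rw [map_smul, smul_comm]
      rw [Finset.sum_congr rfl this, ← Finset.smul_sum, ← map_sum, hsum1, map_smul, smul_smul]
      congr 1
      field_simp
    have := ContinuousLinearMap.norm_sum_smul_le_one (Finset.range m) P (fun j => ζ ^ j) hP hP1
      (fun j _ => by rw [norm_pow, hn, one_pow])
    rw [hPu, norm_smul, norm_div, Complex.norm_natCast, Complex.norm_natCast, div_mul_eq_mul_div,
      div_le_one (by positivity)] at this
    rw [hN] at this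
    exact_mod_cast this
  by_contra! h
  obtain ⟨n, hn⟩ := exists_nat_gt (1 / (‖Φ u‖ - 1))
  rw [div_lt_iff₀ (by linarith)] at hn
  linarith [key n]

/-- The sum of a unitary and an element of norm less than one is a sum of two unitaries. -/
theorem exists_unitary_add_eq_add {a u : A} (ha : ‖a‖ < 1) (hu : u ∈ unitary A) :
    ∃ v ∈ unitary A, ∃ w ∈ unitary A, u + a = v + w := by
  let _ := CStarAlgebra.spectralOrder A
  let _ := CStarAlgebra.spectralOrderedRing A
  obtain ⟨hu1, hu2⟩ := Unitary.mem_iff.mp hu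
  -- `x` is invertible because `‖u⋆a‖ < 1`. Its polar decomposition is `x = v p` with `‖p‖ ≤ 1`, and
  -- `p` is the mean of the unitaries `p ± i √(1 - p²)`.
  let x : A := (1 / 2 : ℂ) • (u + a)
  have hxu : IsUnit x := by
    have h1 : ‖-(star u * a)‖ < 1 := by
      rw [norm_neg]
      rwa [CStarRing.norm_mem_unitary_mul a (Unitary.star_mem hu)]
    have h2 : IsUnit (1 - -(star u * a)) := isUnit_one_sub_of_norm_lt_one h1
    have h3 : IsUnit u := ⟨⟨u, star u, hu2, hu1⟩, rfl⟩
    have h4 : u + a = u * (1 - -(star u * a)) := by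
      rw [sub_neg_eq_add, mul_add, mul_one, ← mul_assoc, hu2, one_mul]
    have h5 : IsUnit (u + a) := h4 ▸ h3.mul h2
    have h6 : x = algebraMap ℂ A (1 / 2) * (u + a) := by rw [← Algebra.smul_def]
    rw [h6]
    exact ((IsUnit.mk0 (1 / 2 : ℂ) (by norm_num)).map (algebraMap ℂ A)).mul h5
  have hx1 : ‖x‖ ≤ 1 := by
    have h1 : ‖u‖ ≤ 1 := by
      nontriviality A
      exact (CStarRing.norm_of_mem_unitary hu).le
    have h2 := norm_add_le u a
    rw [norm_smul]
    norm_num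
    linarith
  let p : A := CFC.abs x
  have hpp : p * p = star x * x := CFC.abs_mul_abs x
  have hps : star p = p := (CFC.abs_nonneg x).isSelfAdjoint
  have hp1 : ‖p‖ ≤ 1 := by rw [CFC.norm_abs]; exact hx1
  have hpu : IsUnit p := by
    have : IsUnit (p * p) := hpp ▸ hxu.star.mul hxu
    exact ((Commute.refl p).isUnit_mul_iff.mp this).1
  obtain ⟨P, hP⟩ := hpu
  have hPs : star (↑P⁻¹ : A) = ↑P⁻¹ := by
    have : star P = P := Units.ext (by rw [Units.coe_star, hP, hps])
    rw [← Units.coe_star, star_inv, this]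
  let v : A := x * ↑P⁻¹
  have hvp : v * p = x := by rw [← hP]; simp [v, mul_assoc]
  have hv1 : star v * v = 1 := by
    calc star v * v = ↑P⁻¹ * (star x * x) * ↑P⁻¹ := by simp only [v, star_mul, hPs, mul_assoc]
      _ = 1 := by rw [← hpp, ← hP]; simp
  have hvu : IsUnit v := hxu.mul (P⁻¹).isUnit
  have hv : v ∈ unitary A := by
    refine Unitary.mem_iff.mpr ⟨hv1, ?_⟩
    obtain ⟨V, hV⟩ := hvu
    have : star v = ↑V⁻¹ := by
      rw [← hV] at hv1 ⊢
      exact Units.eq_inv_of_mul_eq_one_right hv1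
    rw [this, ← hV, Units.mul_inv]
  let q : selfAdjoint A := ⟨p, hps⟩
  let W := selfAdjoint.unitarySelfAddISMul q hp1
  have hW : (W : A) + star (W : A) = (2 : ℂ) • p := by
    have h1 : star (W : A) = p - _ := selfAdjoint.star_coe_unitarySelfAddISMul q hp1
    have h2 : (W : A) = p + _ := selfAdjoint.unitarySelfAddISMul_coe q hp1
    rw [h1, h2]
    module
  refine ⟨v * W, mul_mem hv W.2, v * star (W : A), mul_mem hv (Unitary.star_mem W.2), ?_⟩
  rw [← mul_add, hW, mul_smul_comm, hvp]
  module

/-- A unital positive map from a unital C⋆-algebra to the bounded operators is contractive. -/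
theorem norm_map_le_of_positive_of_unital (Φ : A →ₗ[ℂ] (H →L[ℂ] H))
    (hpos : ∀ a, 0 ≤ Φ (star a * a)) (hone : Φ 1 = 1) (a : A) : ‖Φ a‖ ≤ ‖a‖ := by
  have hlt : ∀ a : A, ‖a‖ < 1 → ‖Φ a‖ ≤ 1 := by
    intro a ha
    -- Writing `u + a = v + w` splits off one unitary and leaves `w + n a`, to which the induction
    -- applies. Dividing by `n` then bounds `Φ a`.
    have hsum : ∀ n : ℕ, ∀ u ∈ unitary A, ‖Φ (u + (n : ℂ) • a)‖ ≤ n + 1 := by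
      intro n
      induction n with
      | zero => intro u hu; simpa using norm_map_unitary_le_one Φ hpos hone hu
      | succ n ih =>
        intro u hu
        obtain ⟨v, hv, w, hw, h⟩ := exists_unitary_add_eq_add ha hu
        have h1 : u + ((n + 1 : ℕ) : ℂ) • a = v + (w + (n : ℂ) • a) := by
          rw [← add_assoc, ← h]; push_cast; module
        rw [h1, map_add]
        refine (norm_add_le _ _).trans ?_
        have := norm_map_unitary_le_one Φ hpos hone hv
        have := ih w hw
        push_cast
        linarith
    have key : ∀ n : ℕ, (n : ℝ) * ‖Φ a‖ ≤ n + 2 := fun n => by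
      have h1 := hsum n 1 (one_mem _)
      have h2 : (n : ℂ) • Φ a = Φ (1 + (n : ℂ) • a) - Φ 1 := by
        rw [map_add, map_smul]; abel
      have h3 : ‖(n : ℂ) • Φ a‖ ≤ n + 1 + 1 := by
        rw [h2]
        exact (norm_sub_le _ _).trans
          (add_le_add h1 (norm_map_unitary_le_one Φ hpos hone (one_mem _)))
      rw [norm_smul, Complex.norm_natCast] at h3
      linarith
    by_contra! h
    obtain ⟨n, hn⟩ := exists_nat_gt (2 / (‖Φ a‖ - 1))
    rw [div_lt_iff₀ (by linarith)] at hn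
    linarith [key n]
  refine le_of_forall_gt_imp_ge_of_dense fun r hr => ?_
  have hr0 : 0 < r := (norm_nonneg a).trans_lt hr
  have hinv : ‖(r : ℂ)⁻¹‖ = r⁻¹ := by
    rw [norm_inv, Complex.norm_real, Real.norm_of_nonneg hr0.le]
  have h1 := hlt ((r : ℂ)⁻¹ • a) (by
    rw [norm_smul, hinv, inv_mul_lt_iff₀ hr0, mul_one]; exact hr)
  rwa [map_smul, norm_smul, hinv, inv_mul_le_iff₀ hr0, mul_one] at h1

end RussoDye

/-! ### Positivity of operator matrices. -/

section MatrixPositivity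

open scoped ComplexOrder

/-- The commutation clause is what keeps roots of matrices over a von Neumann algebra inside that
algebra. -/
theorem CStarAlgebra.exists_selfAdjoint_mul_self_eq {A : Type*} [CStarAlgebra A] [PartialOrder A]
    [StarOrderedRing A] {a : A} (ha : 0 ≤ a) :
    ∃ s : A, star s = s ∧ s * s = a ∧ ∀ d, Commute a d → Commute s d :=
  ⟨CFC.sqrt a, (CFC.sqrt_nonneg a).isSelfAdjoint, CFC.sqrt_mul_sqrt_self a ha,
    fun _ hd => hd.cfcₙ_nnreal NNReal.sqrt⟩

theorem ContinuousLinearMap.nonneg_iff_inner_nonneg {H : Type*} [NormedAddCommGroup H]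
    [InnerProductSpace ℂ H] (T : H →L[ℂ] H) :
    0 ≤ T ↔ ∀ x, 0 ≤ inner ℂ x (T x) := by
  rw [nonneg_iff_isPositive, isPositive_iff_complex]
  refine forall_congr' fun x => ?_
  have h1 : (inner ℂ x (T x)).re = (inner ℂ (T x) x).re := inner_re_symm (𝕜 := ℂ) _ _
  have h2 : (inner ℂ x (T x)).im = -(inner ℂ (T x) x).im := inner_im_symm (𝕜 := ℂ) _ _
  rw [Complex.nonneg_iff, Complex.ext_iff, h1, h2]
  simp [and_comm, eq_comm]

variable {H : Type*} [NormedAddCommGroup H] [InnerProductSpace ℂ H] [CompleteSpace H]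

namespace CStarMatrix

variable {n : Type*} [Fintype n] [DecidableEq n]

/-- With `M = s⋆ s` the double sum is `∑ₖ ‖∑ᵢ s k i (x i)‖²`. -/
theorem sum_inner_nonneg {M : CStarMatrix n n (H →L[ℂ] H)} (hM : 0 ≤ M) (x : n → H) :
    0 ≤ ∑ i, ∑ j, inner ℂ (x i) (M i j (x j)) := by
  obtain ⟨s, hs, hsM, -⟩ := CStarAlgebra.exists_selfAdjoint_mul_self_eq hM
  have hentry : ∀ i j, M i j = ∑ k, star (s k i) * s k j := fun i j => by
    rw [← hsM, mul_apply]
    refine Finset.sum_congr rfl fun k _ => ?_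
    rw [← star_apply, hs]
  have hsum : ∑ i, ∑ j, inner ℂ (x i) (M i j (x j)) =
      ∑ k, inner ℂ (∑ i, s k i (x i)) (∑ j, s k j (x j)) := by
    simp only [hentry, sum_apply, inner_sum, sum_inner, mul_apply_eq_comp,
      ContinuousLinearMap.star_eq_adjoint, ContinuousLinearMap.adjoint_inner_right]
    rw [Finset.sum_congr rfl fun i _ => Finset.sum_comm, Finset.sum_comm]
    exact Finset.sum_congr rfl fun k _ => Finset.sum_comm
  rw [hsum]
  exact Finset.sum_nonneg fun k _ => by
    rw [inner_self_eq_norm_sq_to_K]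
    rw [← RCLike.ofReal_pow]
    exact Complex.zero_le_real.mpr (sq_nonneg _)

/-- The conditions on `π` present `E` as an orthogonal sum of copies of `H`. The matrix becomes a
positive operator on `E`, and the blocks of its square root form a matrix `N` with `M = N⋆ N`. -/
theorem nonneg_of_sum_inner_nonneg_of_coordinates {E : Type*} [NormedAddCommGroup E]
    [InnerProductSpace ℂ E] [CompleteSpace E] (π : n → E →L[ℂ] H)
    (hπ : ∀ i j h, π i ((π j).adjoint h) = if i = j then h else 0)
    (hsum : ∀ x, ∑ i, (π i).adjoint (π i x) = x) {M : CStarMatrix n n (H →L[ℂ] H)}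
    (hM : ∀ x : n → H, 0 ≤ ∑ i, ∑ j, inner ℂ (x i) (M i j (x j))) : 0 ≤ M := by
  let T : E →L[ℂ] E := ∑ i, ∑ j, (π i).adjoint ∘L M i j ∘L π j
  have hTapply : ∀ x, T x = ∑ i, ∑ j, (π i).adjoint (M i j (π j x)) := fun x => by
    simp only [T, sum_apply]
    rfl
  have hT : 0 ≤ T := by
    rw [ContinuousLinearMap.nonneg_iff_inner_nonneg]
    intro x
    simp only [hTapply, inner_sum, ContinuousLinearMap.adjoint_inner_right]
    exact hM fun i => π i x
  obtain ⟨S, hS, hSS, -⟩ := CStarAlgebra.exists_selfAdjoint_mul_self_eq hT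
  rw [ContinuousLinearMap.star_eq_adjoint] at hS
  let N : CStarMatrix n n (H →L[ℂ] H) :=
    ofMatrix (Matrix.of fun i j => π i ∘L S ∘L (π j).adjoint)
  have hMN : M = star N * N := by
    ext i j h
    have h1 : M i j h = π i (T ((π j).adjoint h)) := by
      simp only [hTapply, map_sum, hπ]
      rw [Finset.sum_eq_single i, Finset.sum_eq_single j]
      · simp
      · intro k _ hk; simp [hk]
      · simp
      · intro k _ hk; simp [hk.symm]
      · simp
    have h2 : ∀ k, star (N k i) = π i ∘L S ∘L (π k).adjoint := fun k => by
      change (π k ∘L S ∘L (π i).adjoint).adjoint = _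
      rw [ContinuousLinearMap.adjoint_comp, ContinuousLinearMap.adjoint_comp, hS,
        ContinuousLinearMap.adjoint_adjoint]
      rfl
    have h3 : (star N * N) i j h =
        ∑ k, π i (S ((π k).adjoint (π k (S ((π j).adjoint h))))) := by
      rw [mul_apply, sum_apply]
      refine Finset.sum_congr rfl fun k _ => ?_
      rw [star_apply, h2]
      rfl
    rw [h1, h3, ← map_sum, ← map_sum, hsum, ← hSS, mul_apply_eq_comp]
  rw [hMN]
  exact star_mul_self_nonneg N

theorem nonneg_of_sum_inner_nonneg {M : CStarMatrix n n (H →L[ℂ] H)}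
    (hM : ∀ x : n → H, 0 ≤ ∑ i, ∑ j, inner ℂ (x i) (M i j (x j))) : 0 ≤ M := by
  let π : n → PiLp 2 (fun _ : n => H) →L[ℂ] H := fun i => PiLp.proj 2 (fun _ : n => H) i
  have hπ : ∀ i x, π i x = x i := fun _ _ => rfl
  have hι : ∀ i h, (π i).adjoint h = PiLp.single 2 i h := fun i h =>
    ext_inner_left ℂ fun x => by
      rw [ContinuousLinearMap.adjoint_inner_right, PiLp.inner_apply, Finset.sum_eq_single i]
      · simp [hπ]
      · intro j _ hj
        rw [PiLp.single_eq_of_ne _ hj, inner_zero_right]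
      · simp
  have hπι : ∀ i j h, π i ((π j).adjoint h) = if i = j then h else 0 := fun i j h => by
    rw [hι, hπ]
    split_ifs with hij
    · subst hij; simp
    · simp [hij]
  refine nonneg_of_sum_inner_nonneg_of_coordinates π hπι (fun x => ?_) hM
  ext j
  rw [← hπ, map_sum]
  simp only [hπι, Finset.sum_ite_eq, Finset.mem_univ, if_true, hπ]

end CStarMatrix

/-- A positive matrix over a von Neumann algebra is of the form `d⋆ d`, with `d` a matrix over the
same algebra. -/
theorem VonNeumannAlgebra.exists_matrix_eq_sum_star_mul {n : Type*} [Fintype n] [DecidableEq n]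
    (S : VonNeumannAlgebra H) {M : CStarMatrix n n (H →L[ℂ] H)} (hM : 0 ≤ M)
    (hmem : ∀ i j, M i j ∈ S) :
    ∃ d : n → n → H →L[ℂ] H, (∀ i j, d i j ∈ S) ∧ ∀ i j, M i j = ∑ k, star (d k i) * d k j := by
  obtain ⟨s, hs, hsM, hsc⟩ := CStarAlgebra.exists_selfAdjoint_mul_self_eq hM
  refine ⟨fun i j => s i j, fun i j => ?_, fun i j => ?_⟩
  · rw [← S.commutant_commutant, mem_commutant_iff]
    intro x hx
    -- The diagonal matrix of `x` commutes with `M`, hence with its root `s`; so the entries of `s`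
    -- lie in the bicommutant.
    let D : CStarMatrix n n (H →L[ℂ] H) := CStarMatrix.ofMatrix (Matrix.diagonal fun _ => x)
    have hDl : ∀ (X : CStarMatrix n n (H →L[ℂ] H)) i j, (D * X) i j = x * X i j := fun X i j =>
      Matrix.diagonal_mul (fun _ => x) X i j
    have hDr : ∀ (X : CStarMatrix n n (H →L[ℂ] H)) i j, (X * D) i j = X i j * x := fun X i j =>
      Matrix.mul_diagonal (fun _ => x) X i j
    have hD : Commute M D := by
      refine CStarMatrix.ext fun i j => ?_
      rw [hDl, hDr]
      exact mem_commutant_iff.mp hx _ (hmem i j)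
    exact (hDl s i j).symm.trans ((congrArg (fun X => X i j) (hsc D hD).eq.symm).trans (hDr s i j))
  · rw [← hsM, CStarMatrix.mul_apply]
    refine Finset.sum_congr rfl fun k _ => ?_
    rw [← CStarMatrix.star_apply, hs]

end MatrixPositivity

/-! ### Cauchy–Schwarz for positive functionals. -/

section PositiveFunctional

open scoped ComplexOrder

variable {R : Type*} [Ring R] [StarRing R] [Algebra ℂ R] [StarModule ℂ R]

/-- Reality of `φ` on `(1 + a)⋆(1 + a)` fixes the imaginary part of `φ(a⋆)`; reality on `(1 + ia)⋆(1
+ ia)` fixes the real part. -/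
theorem map_star_eq_conj_of_positive (φ : R →ₗ[ℂ] ℂ) (hφ : ∀ a, 0 ≤ φ (star a * a)) (a : R) :
    φ (star a) = starRingEnd ℂ (φ a) := by
  have him : ∀ a, (φ (star a * a)).im = 0 := fun a => ((Complex.nonneg_iff.mp (hφ a)).2).symm
  have h1 := him 1
  have h2 := him a
  have h3 := him (1 + a)
  have h4 := him (1 + Complex.I • a)
  simp only [star_add, star_one, add_mul, mul_add, one_mul, mul_one, map_add, star_smul,
    smul_mul_assoc, mul_smul_comm, map_smul, Complex.add_im, smul_eq_mul] at h1 h2 h3 h4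
  simp at h1 h2 h3 h4
  apply Complex.ext
  · simp; linarith
  · simp; linarith

theorem norm_map_star_mul_sq_le (φ : R →ₗ[ℂ] ℂ) (hφ : ∀ a, 0 ≤ φ (star a * a)) (a b : R) :
    ‖φ (star a * b)‖ ^ 2 ≤ ‖φ (star a * a)‖ * ‖φ (star b * b)‖ := by
  let core : PreInnerProductSpace.Core ℂ R :=
    { inner := fun x y => φ (star x * y)
      conj_inner_symm := fun x y => by
        rw [← map_star_eq_conj_of_positive φ hφ, star_mul, star_star]
      re_inner_nonneg := fun x => (Complex.nonneg_iff.mp (hφ x)).1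
      add_left := fun x y z => by rw [star_add, add_mul, map_add]
      smul_left := fun x y r => by
        rw [star_smul, smul_mul_assoc, map_smul]; rfl }
  have h := @InnerProductSpace.Core.inner_mul_inner_self_le ℂ R _ _ _ core a b
  have hre : ∀ x, RCLike.re (φ (star x * x)) = ‖φ (star x * x)‖ := fun x =>
    (Complex.re_eq_norm.mpr (hφ x))
  change ‖φ (star a * b)‖ * ‖φ (star b * a)‖ ≤
    RCLike.re (φ (star a * a)) * RCLike.re (φ (star b * b)) at h
  have hsymm : ‖φ (star b * a)‖ = ‖φ (star a * b)‖ := by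
    rw [← RCLike.norm_conj (φ (star a * b)), ← map_star_eq_conj_of_positive φ hφ, star_mul,
      star_star]
  rwa [hsymm, hre, hre, ← sq] at h

end PositiveFunctional

/-! ### Existence and uniqueness of the dual map. -/

namespace TwistedDuality

open scoped ComplexOrder

variable {H K : Type*} [NormedAddCommGroup H] [InnerProductSpace ℂ H] [CompleteSpace H]
  [NormedAddCommGroup K] [InnerProductSpace ℂ K] [CompleteSpace K]

namespace SpatialGradedVN

variable (A : SpatialGradedVN H)

/-- Since `T` commutes with `c⋆`, its matrix coefficients on the orbit of `ξ` depend only on the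
functional `a ↦ ω(T a)`. With `ξ` cyclic, this functional determines `T` and its positivity. -/
theorem inner_commutant {T : H →L[ℂ] H} (hT : T ∈ A.alg.commutant) (a c : A.alg) :
    inner ℂ ((c : H →L[ℂ] H) A.ξ) (T ((a : H →L[ℂ] H) A.ξ)) =
      A.ω (T * ((star c * a : A.alg) : H →L[ℂ] H)) := by
  have h : T * ((star c * a : A.alg) : H →L[ℂ] H) = star (c : H →L[ℂ] H) * (T * a) := by
    change T * (star (c : H →L[ℂ] H) * a) = _
    rw [← mul_assoc, ← mul_assoc, VonNeumannAlgebra.mem_commutant_iff.mp hT _ (star_mem c.2)]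
  rw [h]
  exact (ContinuousLinearMap.adjoint_inner_right _ _ _).symm

variable {A}

theorem commutant_ext (hA : A.IsCyclic) {S T : H →L[ℂ] H} (hS : S ∈ A.alg.commutant)
    (hT : T ∈ A.alg.commutant) (h : ∀ a : A.alg, A.ω (S * a) = A.ω (T * a)) : S = T := by
  refine ContinuousLinearMap.ext fun x => congrFun
    (hA.equalizer S.continuous T.continuous (funext fun a => ?_)) x
  refine DenseRange.eq_of_inner_right (𝕜 := ℂ) hA fun c => ?_
  exact (A.inner_commutant hS a c).trans ((h _).trans (A.inner_commutant hT a c).symm)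

/-- A functional bounded with respect to the vector functional is implemented by an element of the
commutant. -/
theorem exists_mem_commutant (hA : A.IsCyclic) (φ : A.alg →ₗ[ℂ] ℂ) (C : ℝ)
    (hφ : ∀ c a : A.alg, ‖φ (star c * a)‖ ≤
      C * ‖(c : H →L[ℂ] H) A.ξ‖ * ‖(a : H →L[ℂ] H) A.ξ‖) :
    ∃ T ∈ A.alg.commutant, ∀ a : A.alg, A.ω (T * a) = φ a := by
  let e : A.alg →ₗ[ℂ] H :=
    { toFun := fun a => (a : H →L[ℂ] H) A.ξ
      map_add' := fun _ _ => rfl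
      map_smul' := fun _ _ => rfl }
  have he : DenseRange e := hA
  -- Riesz representation in the variable `c`, with a conjugate to make it linear; `v` is the future
  -- value `T(aξ)`.
  have hv : ∀ a : A.alg, ∃ v : H, ∀ c : A.alg, inner ℂ (e c) v = φ (star c * a) := by
    intro a
    let f : A.alg →ₗ[ℂ] ℂ :=
      { toFun := fun c => starRingEnd ℂ (φ (star c * a))
        map_add' := fun x y => by rw [star_add, add_mul, map_add, map_add]
        map_smul' := fun r x => by
          have : star (r • x) = star r • star x := Subtype.ext (star_smul r (x : H →L[ℂ] H))
          rw [this, smul_mul_assoc, map_smul, smul_eq_mul, map_mul]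
          simp }
    have hf : ∃ D, ∀ c, ‖f c‖ ≤ D * ‖e c‖ := ⟨C * ‖e a‖, fun c => by
      refine (RCLike.norm_conj _).trans_le ((hφ c a).trans (le_of_eq ?_))
      change C * ‖e c‖ * ‖e a‖ = _
      ring⟩
    let F : H →L[ℂ] ℂ := f.extendOfNorm e
    refine ⟨(InnerProductSpace.toDual ℂ H).symm F, fun c => ?_⟩
    rw [← inner_conj_symm, InnerProductSpace.toDual_symm_apply,
      LinearMap.extendOfNorm_eq he hf]
    exact Complex.conj_conj _
  choose v hv using hv
  let V : A.alg →ₗ[ℂ] H :=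
    { toFun := v
      map_add' := fun x y => DenseRange.eq_of_inner_right (𝕜 := ℂ) he fun c => by
        rw [inner_add_right, hv, hv, hv, mul_add, map_add]
      map_smul' := fun r x => DenseRange.eq_of_inner_right (𝕜 := ℂ) he fun c => by
        rw [RingHom.id_apply, inner_smul_right, hv, hv, mul_smul_comm, map_smul, smul_eq_mul] }
  have hV : ∃ D, ∀ a, ‖V a‖ ≤ D * ‖e a‖ := by
    refine ⟨C, fun a => ?_⟩
    -- Density extends the bound from orbit vectors to all `x`; it is then used at `x = v a`.
    have hle : ∀ x : H, ‖inner ℂ x (v a)‖ ≤ C * ‖x‖ * ‖e a‖ := fun x => by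
      refine he.induction_on (p := fun x => ‖inner ℂ x (v a)‖ ≤ C * ‖x‖ * ‖e a‖) x
        (isClosed_le (by fun_prop) (by fun_prop)) fun c => ?_
      rw [hv]
      exact hφ c a
    have h1 := hle (v a)
    rw [inner_self_eq_norm_sq_to_K] at h1
    simp only [norm_pow, RCLike.norm_ofReal, abs_norm] at h1
    change ‖v a‖ ≤ _
    rcases (norm_nonneg (v a)).eq_or_lt with h0 | h0
    -- `C` has no assumed sign, so `0 ≤ C * ‖e a‖` is extracted from the bound itself.
    · rw [← h0]
      have h2 := (norm_nonneg _).trans (hφ a a)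
      change 0 ≤ C * ‖e a‖ * ‖e a‖ at h2
      rcases (norm_nonneg (e a)).eq_or_lt with h3 | h3
      · rw [← h3, mul_zero]
      · exact nonneg_of_mul_nonneg_left h2 h3
    · refine le_of_mul_le_mul_right ?_ h0
      linarith
  let T : H →L[ℂ] H := V.extendOfNorm e
  have hT : ∀ a, T (e a) = v a := fun a => LinearMap.extendOfNorm_eq he hV a
  have hTmem : T ∈ A.alg.commutant := by
    rw [VonNeumannAlgebra.mem_commutant_iff]
    intro g hg
    refine ContinuousLinearMap.ext fun x => congrFun
      (he.equalizer (g * T).continuous (T * g).continuous (funext fun a => ?_)) x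
    refine DenseRange.eq_of_inner_right (𝕜 := ℂ) he fun c => ?_
    let G : A.alg := ⟨g, hg⟩
    have h1 : g (e a) = e (G * a) := rfl
    have h2 : star g (e c) = e (star G * c) := rfl
    change inner ℂ (e c) (g (T (e a))) = inner ℂ (e c) (T (g (e a)))
    rw [h1, hT, hT, ← ContinuousLinearMap.adjoint_inner_left, ← ContinuousLinearMap.star_eq_adjoint,
      h2, hv, hv, star_mul, star_star, mul_assoc]
  refine ⟨T, hTmem, fun a => ?_⟩
  have h1 : A.ω (T * a) = inner ℂ (e 1) (T (e a)) := rfl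
  rw [h1, hT, hv, star_one, one_mul]

end SpatialGradedVN

variable {A : SpatialGradedVN H} {B : SpatialGradedVN K} {Ψ : A.alg →ₗ[ℂ] B.alg}

theorem nonneg_star_mul_self {M : VonNeumannAlgebra H} (a : M) :
    0 ≤ ((star a * a : M) : H →L[ℂ] H) :=
  star_mul_self_nonneg (a : H →L[ℂ] H)

theorem ω_commutant_mul_map_nonneg (hpos : IsPositiveMap Ψ) {b : K →L[ℂ] K}
    (hb : b ∈ B.alg.commutant) (hb0 : 0 ≤ b) (a : A.alg) :
    0 ≤ B.ω (b * Ψ (star a * a)) := by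
  have h1 := hpos _ (nonneg_star_mul_self a)
  have h2 : Commute b (Ψ (star a * a) : K →L[ℂ] K) :=
    (VonNeumannAlgebra.mem_commutant_iff.mp hb _ (Ψ (star a * a)).2).symm
  exact (ContinuousLinearMap.nonneg_iff_inner_nonneg _).mp (h2.mul_nonneg hb0 h1) _

/-- The functional `a ↦ ⟨b Ψ(a) ξ, ξ⟩`. -/
noncomputable def dualFunctional (A : SpatialGradedVN H) (B : SpatialGradedVN K)
    (Ψ : A.alg →ₗ[ℂ] B.alg) (b : K →L[ℂ] K) : A.alg →ₗ[ℂ] ℂ where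
  toFun a := B.ω (b * Ψ a)
  map_add' x y := by
    rw [map_add]
    change inner ℂ B.ξ (b ((Ψ x : K →L[ℂ] K) B.ξ + (Ψ y : K →L[ℂ] K) B.ξ)) = _
    rw [map_add, inner_add_right]
    rfl
  map_smul' r x := by
    rw [map_smul]
    change inner ℂ B.ξ (b (r • (Ψ x : K →L[ℂ] K) B.ξ)) = _
    rw [map_smul, inner_smul_right]
    rfl

/-- Both `b` and `‖b‖ - b` are positive in the commutant, so the functional lies between `0` and
`‖b‖ μ` on elements `x⋆x`. Cauchy–Schwarz gives the hypothesis of `exists_mem_commutant` with `C =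
‖b‖`. -/
theorem exists_dual_apply_of_nonneg (hA : A.IsCyclic) (hpos : IsPositiveMap Ψ)
    (hstate : PreservesState A B Ψ) {b : K →L[ℂ] K} (hb : b ∈ B.alg.commutant) (hb0 : 0 ≤ b) :
    ∃ T ∈ A.alg.commutant, ∀ a : A.alg, A.ω (T * a) = B.ω (b * Ψ a) := by
  have hφ := ω_commutant_mul_map_nonneg hpos hb hb0
  refine SpatialGradedVN.exists_mem_commutant hA (dualFunctional A B Ψ b) ‖b‖ fun c a => ?_
  have hle : ∀ x : A.alg, ‖dualFunctional A B Ψ b (star x * x)‖ ≤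
      ‖b‖ * ‖(x : H →L[ℂ] H) A.ξ‖ ^ 2 := fun x => by
    have h1 : (algebraMap ℂ (K →L[ℂ] K) ‖b‖ - b) ∈ B.alg.commutant :=
      sub_mem (B.alg.commutant.toStarSubalgebra.algebraMap_mem _) hb
    have h2 : 0 ≤ algebraMap ℂ (K →L[ℂ] K) ‖b‖ - b := by
      rw [sub_nonneg]
      exact (IsSelfAdjoint.of_nonneg hb0).le_algebraMap_norm_self
    have h3 := ω_commutant_mul_map_nonneg hpos h1 h2 x
    have h4 : B.ω ((algebraMap ℂ (K →L[ℂ] K) ‖b‖ - b) * Ψ (star x * x)) =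
        (‖b‖ : ℂ) * (‖(x : H →L[ℂ] H) A.ξ‖ : ℂ) ^ 2 - dualFunctional A B Ψ b (star x * x) := by
      have h5 : B.ω (Ψ (star x * x)) = (‖(x : H →L[ℂ] H) A.ξ‖ : ℂ) ^ 2 := by
        rw [hstate]
        have := A.inner_commutant (one_mem A.alg.commutant) x x
        rw [one_mul, one_apply_eq_self, inner_self_eq_norm_sq_to_K] at this
        exact this.symm
      rw [← h5, sub_mul, ← Algebra.smul_def]
      change inner ℂ B.ξ ((‖b‖ : ℂ) • (Ψ (star x * x) : K →L[ℂ] K) B.ξ - _) = _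
      rw [inner_sub_right, inner_smul_right]
      rfl
    rw [h4, sub_nonneg] at h3
    have h6 := hφ x
    have h7 : dualFunctional A B Ψ b (star x * x) = ‖dualFunctional A B Ψ b (star x * x)‖ :=
      Complex.eq_coe_norm_of_nonneg h6
    rw [h7] at h3
    exact_mod_cast h3
  have hcs := norm_map_star_mul_sq_le (dualFunctional A B Ψ b) hφ c a
  refine abs_le_of_sq_le_sq' ?_ (by positivity) |>.2
  calc _ ≤ _ := hcs
    _ ≤ (‖b‖ * ‖(c : H →L[ℂ] H) A.ξ‖ ^ 2) * (‖b‖ * ‖(a : H →L[ℂ] H) A.ξ‖ ^ 2) := by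
        gcongr <;> exact hle _
    _ = _ := by ring

/-- The property is stable under linear combinations; a self-adjoint `x` is `(x + ‖x‖) - ‖x‖`, and a
general `b` splits into real and imaginary parts. -/
theorem exists_dual_apply (hA : A.IsCyclic) (hpos : IsPositiveMap Ψ)
    (hstate : PreservesState A B Ψ) {b : K →L[ℂ] K} (hb : b ∈ B.alg.commutant) :
    ∃ T ∈ A.alg.commutant, ∀ a : A.alg, A.ω (T * a) = B.ω (b * Ψ a) := by
  let P : (K →L[ℂ] K) → Prop := fun b =>
    ∃ T ∈ A.alg.commutant, ∀ a : A.alg, A.ω (T * a) = B.ω (b * Ψ a)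
  have hcomb : ∀ (r s : ℂ) (x y : K →L[ℂ] K), P x → P y → P (r • x + s • y) := by
    rintro r s x y ⟨S, hS, hSx⟩ ⟨T, hT, hTy⟩
    refine ⟨r • S + s • T, add_mem (SMulMemClass.smul_mem r hS) (SMulMemClass.smul_mem s hT),
      fun a => ?_⟩
    have h1 := hSx a
    have h2 := hTy a
    simp only [SpatialGradedVN.ω, add_mul, smul_mul_assoc, add_apply, smul_apply, inner_add_right,
      inner_smul_right] at h1 h2 ⊢
    rw [h1, h2]
  have hsa : ∀ x ∈ B.alg.commutant, IsSelfAdjoint x → P x := by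
    intro x hx hxs
    have h1 : (algebraMap ℂ (K →L[ℂ] K) ‖x‖) ∈ B.alg.commutant :=
      B.alg.commutant.toStarSubalgebra.algebraMap_mem _
    have h2 : 0 ≤ algebraMap ℂ (K →L[ℂ] K) ‖x‖ := by
      have : algebraMap ℂ (K →L[ℂ] K) ‖x‖ = ‖x‖ • (1 : K →L[ℂ] K) := by
        rw [Algebra.algebraMap_eq_smul_one, Complex.coe_smul]
      rw [this]
      exact smul_nonneg (norm_nonneg _) zero_le_one
    have h3 : 0 ≤ x + algebraMap ℂ (K →L[ℂ] K) ‖x‖ := by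
      have := hxs.neg_algebraMap_norm_le_self
      rw [neg_le_iff_add_nonneg] at this
      exact this
    have := hcomb 1 (-1) _ _
      (exists_dual_apply_of_nonneg hA hpos hstate (add_mem hx h1) h3)
      (exists_dual_apply_of_nonneg hA hpos hstate h1 h2)
    simpa using this
  have h1 : (realPart b : K →L[ℂ] K) ∈ B.alg.commutant := by
    rw [realPart_apply_coe, ← Complex.coe_smul]
    exact SMulMemClass.smul_mem _ (add_mem hb (star_mem hb))
  have h2 : (imaginaryPart b : K →L[ℂ] K) ∈ B.alg.commutant := by
    rw [imaginaryPart_apply_coe, ← Complex.coe_smul]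
    exact SMulMemClass.smul_mem _ (SMulMemClass.smul_mem _ (sub_mem hb (star_mem hb)))
  have := hcomb 1 Complex.I _ _ (hsa _ h1 (realPart b).2) (hsa _ h2 (imaginaryPart b).2)
  rwa [one_smul, realPart_add_I_smul_imaginaryPart] at this

theorem hasDual_of_isDual (hA : A.IsCyclic)
    (h : ∃ Φ : B.alg.commutant →ₗ[ℂ] A.alg.commutant, IsDual A B Ψ Φ) : HasDual A B Ψ := by
  have hd : IsDual A B Ψ (dual A B Ψ) := by
    rw [dual, dif_pos h]
    exact h.choose_spec
  refine ⟨hd, fun Φ hΦ => funext fun b => Subtype.ext ?_⟩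
  exact SpatialGradedVN.commutant_ext hA (Φ b).2 (dual A B Ψ b).2 fun a =>
    (hΦ b a).trans (hd b a).symm

theorem hasDual (hA : A.IsCyclic) (hpos : IsPositiveMap Ψ) (hstate : PreservesState A B Ψ) :
    HasDual A B Ψ := by
  refine hasDual_of_isDual hA ?_
  choose T hT hTd using fun b : B.alg.commutant => exists_dual_apply hA hpos hstate b.2
  refine ⟨{ toFun := fun b => ⟨T b, hT b⟩, map_add' := fun x y => Subtype.ext ?_,
            map_smul' := fun r x => Subtype.ext ?_ }, fun b a => hTd b a⟩
  · refine SpatialGradedVN.commutant_ext hA (hT _) (add_mem (hT x) (hT y)) fun a => ?_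
    have h1 := hTd x a
    have h2 := hTd y a
    rw [hTd]
    change B.ω (((x : K →L[ℂ] K) + y) * Ψ a) = A.ω ((T x + T y) * a)
    simp only [SpatialGradedVN.ω, add_mul, add_apply, inner_add_right] at h1 h2 ⊢
    rw [h1, h2]
  · refine SpatialGradedVN.commutant_ext hA (hT _) (SMulMemClass.smul_mem r (hT x)) fun a => ?_
    have h1 := hTd x a
    rw [hTd]
    change B.ω ((r • (x : K →L[ℂ] K)) * Ψ a) = A.ω ((r • T x) * a)
    simp only [SpatialGradedVN.ω, smul_mul_assoc, smul_apply, inner_smul_right] at h1 ⊢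
    rw [h1]

end TwistedDuality

/-! ### Closedness, positivity under `*`-homomorphisms, Gram matrices and the action of `Γ`. -/

/-- A von Neumann algebra is norm closed. -/
theorem VonNeumannAlgebra.isClosed {H : Type*} [NormedAddCommGroup H]
    [InnerProductSpace ℂ H] [CompleteSpace H] (S : VonNeumannAlgebra H) :
    IsClosed (S : Set (H →L[ℂ] H)) := by
  rw [← S.centralizer_centralizer]
  exact Set.isClosed_centralizer _

theorem StarHom.map_nonneg_of_nonneg {R S F : Type*} [CStarAlgebra R] [PartialOrder R]
    [StarOrderedRing R] [NonUnitalSemiring S] [StarRing S] [PartialOrder S] [StarOrderedRing S]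
    [FunLike F R S] [MulHomClass F R S] [StarHomClass F R S] (f : F) {a : R} (ha : 0 ≤ a) :
    0 ≤ f a := by
  obtain ⟨s, hs, rfl, -⟩ := CStarAlgebra.exists_selfAdjoint_mul_self_eq ha
  rw [map_mul]
  have h : star (f s) = f s := by rw [← map_star, hs]
  have h' := star_mul_self_nonneg (f s)
  rwa [h] at h'

theorem ContinuousLinearMap.inner_star_mul_apply {H : Type*} [NormedAddCommGroup H]
    [InnerProductSpace ℂ H] [CompleteSpace H] (S T : H →L[ℂ] H) (x y : H) :
    inner ℂ x ((star S * T) y) = inner ℂ (S x) (T y) :=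
  adjoint_inner_right S x (T y)

open scoped ComplexOrder in
theorem CStarMatrix.nonneg_star_mul {H n : Type*} [NormedAddCommGroup H] [InnerProductSpace ℂ H]
    [CompleteSpace H] [Fintype n] [DecidableEq n] (a : n → H →L[ℂ] H) :
    0 ≤ ofMatrix (Matrix.of fun i j => star (a i) * a j) := by
  refine nonneg_of_sum_inner_nonneg fun y => ?_
  change 0 ≤ ∑ i, ∑ j, inner ℂ (y i) ((star (a i) * a j) (y j))
  simp only [ContinuousLinearMap.inner_star_mul_apply, ← inner_sum, ← sum_inner]
  rw [inner_self_eq_norm_sq_to_K, ← RCLike.ofReal_pow]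
  exact Complex.zero_le_real.mpr (sq_nonneg _)

namespace TwistedDuality

open scoped ComplexOrder

section Klein

variable {H : Type*} [NormedAddCommGroup H] [InnerProductSpace ℂ H]

theorem klein_conj {Γ : H →L[ℂ] H} (hΓ : Γ * Γ = 1) (a : H →L[ℂ] H) :
    klein Γ (Γ * a * Γ) = Γ * klein Γ a * Γ := by
  simp only [klein_apply, mul_add, add_mul, mul_sub, sub_mul, mul_smul_comm, smul_mul_assoc,
    ← mul_assoc, hΓ, one_mul, mul_sq_cancel hΓ]

theorem klein_one {Γ : H →L[ℂ] H} (hΓ : Γ * Γ = 1) : klein Γ 1 = 1 := by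
  rw [klein_apply, mul_one, hΓ, sub_self, smul_zero, mul_zero, add_zero]
  module

end Klein

variable {H K : Type*} [NormedAddCommGroup H] [InnerProductSpace ℂ H] [CompleteSpace H]
  [NormedAddCommGroup K] [InnerProductSpace ℂ K] [CompleteSpace K]

variable {A : SpatialGradedVN H} {B : SpatialGradedVN K} {Ψ : A.alg →ₗ[ℂ] B.alg}

theorem SpatialGradedVN.inner_ξ_Γ (A : SpatialGradedVN H) (x : H) :
    inner ℂ A.ξ (A.Γ x) = inner ℂ A.ξ x := by
  have h : A.Γ.adjoint = A.Γ := A.star_Γ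
  rw [← ContinuousLinearMap.adjoint_inner_left, h, A.Γ_ξ]

theorem SpatialGradedVN.ω_conj_mul (A : SpatialGradedVN H) (x y : H →L[ℂ] H) :
    A.ω (A.Γ * x * A.Γ * y) = A.ω (x * (A.Γ * y * A.Γ)) := by
  change inner ℂ A.ξ (A.Γ (x (A.Γ (y A.ξ)))) = inner ℂ A.ξ (x (A.Γ (y (A.Γ A.ξ))))
  rw [A.Γ_ξ, A.inner_ξ_Γ]

/-! ### Unitality, evenness and positivity of the dual. -/

section Dual

/-- Unitality of the dual is the dual form of state preservation. -/
theorem dual_one (hA : A.IsCyclic) (hstate : PreservesState A B Ψ) (hd : HasDual A B Ψ) :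
    dual A B Ψ 1 = 1 :=
  Subtype.ext <| SpatialGradedVN.commutant_ext hA (dual A B Ψ 1).2 (one_mem _) fun a => by
    rw [hd.1]
    change B.ω (1 * (Ψ a : K →L[ℂ] K)) = _
    rw [one_mul, hstate]
    exact congrArg A.ω (one_mul _).symm

/-- As `Γ` fixes `ξ`, conjugation by `Γ` moves from one factor to the other inside `ω`; evenness of
`Ψ` links the two sides. -/
theorem dual_conj (hA : A.IsCyclic) (heven : IsEven A B Ψ) (hd : HasDual A B Ψ)
    (b : B.alg.commutant) :
    (dual A B Ψ ⟨B.Γ * b * B.Γ, B.stable_commutant b.2⟩ : H →L[ℂ] H) =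
      A.Γ * dual A B Ψ b * A.Γ := by
  refine SpatialGradedVN.commutant_ext hA (dual A B Ψ _).2
    (A.stable_commutant (dual A B Ψ b).2) fun a => ?_
  have h := hd.1 b (A.γ a)
  rw [heven] at h
  rw [hd.1]
  change B.ω (B.Γ * b * B.Γ * Ψ a) = A.ω (A.Γ * dual A B Ψ b * A.Γ * a)
  rw [B.ω_conj_mul, A.ω_conj_mul]
  exact h.symm

theorem dual_isPositiveMap (hA : A.IsCyclic) (hpos : IsPositiveMap Ψ) (hd : HasDual A B Ψ) :
    IsPositiveMap (dual A B Ψ) := by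
  intro b hb
  rw [ContinuousLinearMap.nonneg_iff_inner_nonneg]
  intro x
  refine DenseRange.induction_on (p := fun x => 0 ≤ inner ℂ x ((dual A B Ψ b : H →L[ℂ] H) x))
    hA x (isClosed_le (by fun_prop) (by fun_prop)) fun a => ?_
  rw [A.inner_commutant (dual A B Ψ b).2, hd.1]
  exact ω_commutant_mul_map_nonneg hpos b.2 hb a

/-- Factor the matrix over the commutant as `d⋆ d`. On vectors `a i ξ` the quadratic form becomes a
sum over `k` of forms of the matrix `Ψ(a i⋆ a j)` at the vectors `d k i ξ`, and the Gram matrix `a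
i⋆ a j` is positive. -/
theorem dual_isNPositive (hA : A.IsCyclic) (hd : HasDual A B Ψ) {n : ℕ} (hΨ : IsNPositive n Ψ) :
    IsNPositive n (dual A B Ψ) := by
  intro b hb
  obtain ⟨d, hdmem, hbd⟩ := B.alg.commutant.exists_matrix_eq_sum_star_mul hb
    (fun i j => (b i j).2)
  have hbd' : ∀ i j, (b i j : K →L[ℂ] K) = ∑ k, star (d k i) * d k j := hbd
  refine CStarMatrix.nonneg_of_sum_inner_nonneg fun x => ?_
  change 0 ≤ ∑ i, ∑ j, inner ℂ (x i) ((dual A B Ψ (b i j) : H →L[ℂ] H) (x j))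
  have hdense : DenseRange (Pi.map fun (_ : Fin n) (a : A.alg) => (a : H →L[ℂ] H) A.ξ) :=
    DenseRange.piMap fun _ => hA
  refine hdense.induction_on
    (p := fun x => 0 ≤ ∑ i, ∑ j, inner ℂ (x i) ((dual A B Ψ (b i j) : H →L[ℂ] H) (x j)))
    x (isClosed_le (by fun_prop) (by fun_prop)) fun a => ?_
  let c : Matrix (Fin n) (Fin n) A.alg := Matrix.of fun i j => star (a i) * a j
  have hc : 0 ≤ CStarMatrix.ofMatrix (c.map fun x => (x : H →L[ℂ] H)) :=
    CStarMatrix.nonneg_star_mul fun i => (a i : H →L[ℂ] H)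
  have hΨc := hΨ c hc
  have hterm : ∀ i j, inner ℂ ((a i : H →L[ℂ] H) A.ξ)
      ((dual A B Ψ (b i j) : H →L[ℂ] H) ((a j : H →L[ℂ] H) A.ξ)) =
      ∑ k, inner ℂ (d k i B.ξ) ((Ψ (c i j) : K →L[ℂ] K) (d k j B.ξ)) := fun i j => by
    rw [A.inner_commutant (dual A B Ψ (b i j)).2, hd.1, hbd', Finset.sum_mul]
    change inner ℂ B.ξ _ = _
    rw [sum_apply, inner_sum]
    refine Finset.sum_congr rfl fun k _ => ?_
    change inner ℂ B.ξ ((star (d k i) * d k j * (Ψ (c i j) : K →L[ℂ] K)) B.ξ) = _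
    -- `d k j` is moved past `Ψ (c i j)` so that it acts on `ξ`.
    rw [mul_assoc, ← VonNeumannAlgebra.mem_commutant_iff.mp (hdmem k j) _ (Ψ (c i j)).2]
    exact ContinuousLinearMap.inner_star_mul_apply _ _ _ _
  have hsum : ∑ i, ∑ j, inner ℂ ((a i : H →L[ℂ] H) A.ξ)
      ((dual A B Ψ (b i j) : H →L[ℂ] H) ((a j : H →L[ℂ] H) A.ξ)) =
      ∑ k, ∑ i, ∑ j, inner ℂ (d k i B.ξ) ((Ψ (c i j) : K →L[ℂ] K) (d k j B.ξ)) := by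
    simp only [hterm]
    rw [Finset.sum_congr rfl fun i _ => Finset.sum_comm, Finset.sum_comm]
  change 0 ≤ ∑ i, ∑ j, inner ℂ ((a i : H →L[ℂ] H) A.ξ)
      ((dual A B Ψ (b i j) : H →L[ℂ] H) ((a j : H →L[ℂ] H) A.ξ))
  rw [hsum]
  exact Finset.sum_nonneg fun k _ => CStarMatrix.sum_inner_nonneg hΨc fun i => d k i B.ξ

end Dual

/-! ### The twisted dual and its norm. -/

section Twist

/-- The twist automorphism as a `*`-automorphism of `B(H)`. -/
noncomputable def SpatialGradedVN.etaStarAlgEquiv (A : SpatialGradedVN H) :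
    (H →L[ℂ] H) ≃⋆ₐ[ℂ] (H →L[ℂ] H) where
  __ := A.η
  map_mul' := twistMap_I_mul A.Γ_mul_Γ
  map_star' a := (twistMap_I_star A.Γ_mul_Γ A.star_Γ a).symm

theorem twistedDual_coe (b : B.twist.alg) :
    (twistedDual A B Ψ b : H →L[ℂ] H) = A.κ (dual A B Ψ ⟨B.κ b, B.κ_mem_commutant b.2⟩) := rfl

/-- `twistMap d ∘ κ` is the same scalar combination of the identity and conjugation by `Γ` on both
spaces, so the dual intertwines the two copies by `dual_conj`. Then `twistMap c` undoes `twistMap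
d`. -/
theorem twistedDual_eq_twistMap (hA : A.IsCyclic) (heven : IsEven A B Ψ) (hd : HasDual A B Ψ)
    {c d : ℂ} (hcd : c * d = 1) (b : B.twist.alg) :
    ∃ hb : twistMap d B.Γ b ∈ B.alg.commutant,
      (twistedDual A B Ψ b : H →L[ℂ] H) =
        twistMap c A.Γ (dual A B Ψ ⟨twistMap d B.Γ b, hb⟩) := by
  let y : B.alg.commutant := ⟨B.κ b, B.κ_mem_commutant b.2⟩
  let y' : B.alg.commutant := ⟨B.Γ * y * B.Γ, B.stable_commutant y.2⟩
  have h1 : twistMap d B.Γ b = ((((1 + d) / 2) • y + ((1 - d) / 2) • y' : B.alg.commutant) :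
      K →L[ℂ] K) := by
    have h := twistMap_klein B.Γ_mul_Γ d (B.κ (b : K →L[ℂ] K))
    rw [klein_klein B.Γ_mul_Γ] at h
    exact h
  have hb : twistMap d B.Γ b ∈ B.alg.commutant := h1 ▸ Subtype.prop _
  refine ⟨hb, ?_⟩
  have h2 : (⟨twistMap d B.Γ b, hb⟩ : B.alg.commutant) = ((1 + d) / 2) • y + ((1 - d) / 2) • y' :=
    Subtype.ext h1
  have h3 : (dual A B Ψ (((1 + d) / 2) • y + ((1 - d) / 2) • y') : H →L[ℂ] H) =
      ((1 + d) / 2) • (dual A B Ψ y : H →L[ℂ] H) +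
        ((1 - d) / 2) • (A.Γ * dual A B Ψ y * A.Γ) := by
    rw [map_add, map_smul, map_smul, ← dual_conj hA heven hd y]
    rfl
  rw [h2, h3, ← twistMap_klein A.Γ_mul_Γ, twistMap_twistMap A.Γ_mul_Γ hcd, twistedDual_coe]

theorem twistedDual_eq_eta (hA : A.IsCyclic) (heven : IsEven A B Ψ) (hd : HasDual A B Ψ)
    (b : B.twist.alg) :
    ∃ hb : B.η.symm b ∈ B.alg.commutant,
      (twistedDual A B Ψ b : H →L[ℂ] H) = A.η (dual A B Ψ ⟨B.η.symm b, hb⟩) :=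
  twistedDual_eq_twistMap hA heven hd (c := Complex.I) (d := -Complex.I) (by simp) b

theorem twistedDual_eq_eta_symm (hA : A.IsCyclic) (heven : IsEven A B Ψ) (hd : HasDual A B Ψ)
    (b : B.twist.alg) :
    ∃ hb : B.η b ∈ B.alg.commutant,
      (twistedDual A B Ψ b : H →L[ℂ] H) = A.η.symm (dual A B Ψ ⟨B.η b, hb⟩) :=
  twistedDual_eq_twistMap hA heven hd (c := -Complex.I) (d := Complex.I) (by simp) b

/-- In the form `η ∘ Ψ' ∘ η⁻¹` the outer maps are `*`-automorphisms, so only positivity of `Ψ'`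
matters. -/
theorem twistedDual_isPositiveMap (hA : A.IsCyclic) (hpos : IsPositiveMap Ψ)
    (heven : IsEven A B Ψ) (hd : HasDual A B Ψ) : IsPositiveMap (twistedDual A B Ψ) := by
  intro b hb
  obtain ⟨hb', h⟩ := twistedDual_eq_eta hA heven hd b
  rw [h]
  refine StarHom.map_nonneg_of_nonneg A.etaStarAlgEquiv (dual_isPositiveMap hA hpos hd _ ?_)
  exact StarHom.map_nonneg_of_nonneg B.etaStarAlgEquiv.symm hb

theorem twistedDual_isNPositive (hA : A.IsCyclic) (heven : IsEven A B Ψ) (hd : HasDual A B Ψ)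
    {n : ℕ} (hΨ : IsNPositive n Ψ) : IsNPositive n (twistedDual A B Ψ) := by
  intro b hb
  choose hb' h using twistedDual_eq_eta hA heven hd
  let f : (K →L[ℂ] K) →⋆ₙₐ[ℂ] (K →L[ℂ] K) :=
    NonUnitalStarAlgHomClass.toNonUnitalStarAlgHom B.etaStarAlgEquiv.symm
  let g : (H →L[ℂ] H) →⋆ₙₐ[ℂ] (H →L[ℂ] H) :=
    NonUnitalStarAlgHomClass.toNonUnitalStarAlgHom A.etaStarAlgEquiv
  let c : Matrix (Fin n) (Fin n) B.alg.commutant := Matrix.of fun i j => ⟨_, hb' (b i j)⟩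
  have hc : 0 ≤ CStarMatrix.ofMatrix (c.map fun x => (x : K →L[ℂ] K)) :=
    StarHom.map_nonneg_of_nonneg (CStarMatrix.mapₙₐ f) hb
  have hdc := StarHom.map_nonneg_of_nonneg (CStarMatrix.mapₙₐ g) (dual_isNPositive hA hd hΨ c hc)
  refine hdc.trans_eq (CStarMatrix.ext fun i j => ?_)
  exact (h (b i j)).symm

theorem twistedDual_isEven (hA : A.IsCyclic) (heven : IsEven A B Ψ) (hd : HasDual A B Ψ) :
    IsEven B.twist A.twist (twistedDual A B Ψ) := by
  intro b
  refine Subtype.ext ?_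
  change A.κ (dual A B Ψ ⟨B.κ (B.Γ * b * B.Γ), _⟩) = A.Γ * A.κ (dual A B Ψ ⟨B.κ b, _⟩) * A.Γ
  rw [← klein_conj A.Γ_mul_Γ, ← dual_conj hA heven hd]
  congr 4
  exact klein_conj B.Γ_mul_Γ _

theorem twistedDual_one (hA : A.IsCyclic) (hstate : PreservesState A B Ψ) (hd : HasDual A B Ψ) :
    twistedDual A B Ψ 1 = 1 := by
  refine Subtype.ext ?_
  have h1 : (⟨B.κ ((1 : B.twist.alg) : K →L[ℂ] K), B.κ_mem_commutant (1 : B.twist.alg).2⟩ :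
      B.alg.commutant) = 1 := Subtype.ext (klein_one B.Γ_mul_Γ)
  rw [twistedDual_coe, h1, dual_one hA hstate hd]
  exact klein_one A.Γ_mul_Γ

theorem norm_twistedDual_le (hA : A.IsCyclic) (hpos : IsPositiveMap Ψ) (heven : IsEven A B Ψ)
    (hstate : PreservesState A B Ψ) (hd : HasDual A B Ψ) (b : B.twist.alg) :
    ‖twistedDual A B Ψ b‖ ≤ ‖b‖ := by
  let val : A.twist.alg →ₗ[ℂ] (H →L[ℂ] H) :=
    { toFun := fun x => x, map_add' := fun _ _ => rfl, map_smul' := fun _ _ => rfl }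
  -- Norm closedness makes the twisted commutant a C⋆-algebra, as Russo–Dye requires.
  have : IsClosed (B.twist.alg : Set (K →L[ℂ] K)) := B.twist.alg.isClosed
  refine norm_map_le_of_positive_of_unital (val ∘ₗ twistedDual A B Ψ) (fun a => ?_) ?_ b
  · exact twistedDual_isPositiveMap hA hpos heven hd _ (nonneg_star_mul_self a)
  · exact congrArg Subtype.val (twistedDual_one hA hstate hd)

theorem exists_continuous_twistedDual (hA : A.IsCyclic) (hpos : IsPositiveMap Ψ)
    (heven : IsEven A B Ψ) (hstate : PreservesState A B Ψ) (hd : HasDual A B Ψ)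
    [Nontrivial H] [Nontrivial K] :
    ∃ Φ : B.twist.alg →L[ℂ] A.twist.alg,
      (Φ : B.twist.alg →ₗ[ℂ] A.twist.alg) = twistedDual A B Ψ ∧ ‖Φ‖ = 1 := by
  let Φ : B.twist.alg →L[ℂ] A.twist.alg := (twistedDual A B Ψ).mkContinuous 1 fun b => by
    rw [one_mul]
    exact norm_twistedDual_le hA hpos heven hstate hd b
  refine ⟨Φ, rfl, le_antisymm (LinearMap.mkContinuous_norm_le _ zero_le_one _) ?_⟩
  have h1 : ‖Φ 1‖ ≤ ‖Φ‖ * ‖(1 : B.twist.alg)‖ := Φ.le_opNorm 1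
  have h2 : ‖(1 : B.twist.alg)‖ = 1 := norm_one (α := K →L[ℂ] K)
  have h3 : ‖(1 : A.twist.alg)‖ = 1 := norm_one (α := H →L[ℂ] H)
  have h4 : Φ 1 = 1 := twistedDual_one hA hstate hd
  rwa [h4, h2, h3, mul_one] at h1

end Twist

/-! ### The bidual. -/

section Bidual

/-- `Γ` fixes `y₊ξ`, so `y₊ξ + Γ y₋ξ = Γ(y₊ξ + y₋ξ)`. -/
theorem SpatialGradedVN.klein_apply_ξ (A : SpatialGradedVN H) (y : H →L[ℂ] H) :
    A.κ y A.ξ = A.Γ (y A.ξ) := by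
  have h : A.Γ * A.Γ = 1 := A.Γ_mul_Γ
  have : ∀ x, A.Γ (A.Γ x) = x := fun x => congrArg (fun T : H →L[ℂ] H => T x) h
  rw [klein_apply]
  simp only [add_apply, sub_apply, smul_apply, mul_apply_eq_comp, A.Γ_ξ, map_smul, map_sub, this]
  module

theorem SpatialGradedVN.ω_klein (A : SpatialGradedVN H) (x : H →L[ℂ] H) :
    A.ω (A.κ x) = A.ω x := by
  change inner ℂ A.ξ (A.κ x A.ξ) = _
  rw [A.klein_apply_ξ, A.inner_ξ_Γ]
  rfl

/-- The right factor gives `Γ z ξ`, and the `Γ` in `a₊ + Γ a₋` is absorbed by `ξ` on the left. -/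
theorem SpatialGradedVN.ω_klein_mul_klein (A : SpatialGradedVN H) (a z : H →L[ℂ] H) :
    A.ω (A.κ a * A.κ z) = A.ω (A.Γ * a * A.Γ * z) := by
  have h3 : ∀ x, A.Γ (A.Γ x) = x := fun x =>
    congrArg (fun T : H →L[ℂ] H => T x) A.Γ_mul_Γ
  change inner ℂ A.ξ (A.κ a (A.κ z A.ξ)) = inner ℂ A.ξ (A.Γ (a (A.Γ (z A.ξ))))
  rw [A.klein_apply_ξ, A.inner_ξ_Γ, klein_apply]
  simp only [add_apply, sub_apply, smul_apply, mul_apply_eq_comp, map_smul, map_sub, h3,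
    inner_add_right, inner_sub_right, inner_smul_right, A.inner_ξ_Γ]
  ring

/-- The projection `p` onto the closure of `M'ξ` has an `M'`-invariant range, so it lies in `M`.
Since `(1 - p)ξ = 0`, separation forces `p = 1`. -/
theorem SpatialGradedVN.denseRange_commutant (h : A.IsSeparating) :
    DenseRange fun y : A.alg.commutant => (y : H →L[ℂ] H) A.ξ := by
  let e : A.alg.commutant →ₗ[ℂ] H :=
    { toFun := fun y => (y : H →L[ℂ] H) A.ξ
      map_add' := fun _ _ => rfl
      map_smul' := fun _ _ => rfl }
  let U : Submodule ℂ H := (LinearMap.range e).topologicalClosure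
  have : CompleteSpace U := (Submodule.isClosed_topologicalClosure _).completeSpace_coe
  let p : H →L[ℂ] H := U.starProjection
  have hp : p ∈ A.alg := by
    rw [VonNeumannAlgebra.IsStarProjection.mem_iff isStarProjection_starProjection]
    intro y hy
    rw [Submodule.range_starProjection, Module.End.mem_invtSubmodule]
    intro x hx
    have hmaps : Set.MapsTo y (LinearMap.range e : Set H) (LinearMap.range e) := by
      rintro _ ⟨z, rfl⟩
      exact ⟨⟨y, hy⟩ * z, rfl⟩
    exact hmaps.closure y.continuous hx
  have hξ : A.ξ ∈ U := Submodule.le_topologicalClosure _ ⟨1, rfl⟩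
  have hp1 : 1 - p = 0 := h _ (sub_mem (one_mem _) hp) <| by
    rw [sub_apply, one_apply_eq_self, Submodule.starProjection_eq_self_iff.mpr hξ, sub_self]
  intro x
  have hx : p x = x := by rw [← sub_eq_zero.mp hp1, one_apply_eq_self]
  exact Submodule.starProjection_eq_self_iff.mp hx

theorem SpatialGradedVN.twist_isCyclic (h : A.IsSeparating) : A.twist.IsCyclic := by
  have hΓ : Function.Surjective A.Γ := fun x =>
    ⟨A.Γ x, congrArg (fun T : H →L[ℂ] H => T x) A.Γ_mul_Γ⟩
  have hd := hΓ.denseRange.comp (denseRange_commutant h) A.Γ.continuous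
  refine Dense.mono ?_ hd
  rintro _ ⟨y, rfl⟩
  exact ⟨A.κToTwist y, A.klein_apply_ξ y⟩

/-- The defining relation at `a = 1`, together with invariance of `ω` under `κ`. -/
theorem twistedDual_preservesState (hd : HasDual A B Ψ) (hone : Ψ 1 = 1) :
    PreservesState B.twist A.twist (twistedDual A B Ψ) := by
  intro b
  have h := hd.1 ⟨B.κ b, B.κ_mem_commutant b.2⟩ 1
  rw [hone] at h
  change A.ω (_ * 1) = B.ω (B.κ b * 1) at h
  rw [mul_one, mul_one, B.ω_klein, ← A.ω_klein] at h
  exact h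

/-- The twisted commutant is the commutant of `η(M)`, so its own commutant is `η(M)`. This equals
`κ(M)` because `κ η` and `η⁻¹ κ` are combinations of the identity and conjugation by `Γ`, both of
which preserve `M`. -/
theorem SpatialGradedVN.mem_twist_commutant_iff (A : SpatialGradedVN H) {x : H →L[ℂ] H} :
    x ∈ A.twist.alg.commutant ↔ A.κ x ∈ A.alg := by
  have hset : (A.twist.alg : Set (H →L[ℂ] H)) = Set.centralizer (A.η '' (A.alg : Set _)) :=
    A.image_klein_commutant
  have hη : ∀ {y}, y ∈ A.alg → twistMap Complex.I A.Γ y ∈ A.twist.alg.commutant := fun {y} hy => by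
    rw [VonNeumannAlgebra.mem_commutant_iff]
    intro g hg
    have : g ∈ (A.twist.alg : Set (H →L[ℂ] H)) := hg
    rw [hset] at this
    exact (this _ ⟨y, hy, rfl⟩).symm
  have hcomb : ∀ (c d : ℂ) (y : H →L[ℂ] H), y ∈ A.alg →
      c • y + d • (A.Γ * y * A.Γ) ∈ A.alg := fun c d y hy =>
    add_mem (SMulMemClass.smul_mem c hy) (SMulMemClass.smul_mem d (A.stable _ hy))
  constructor
  · intro hx
    have hz : twistMap (-Complex.I) A.Γ x ∈ A.alg := by
      rw [← A.alg.commutant_commutant, VonNeumannAlgebra.mem_commutant_iff]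
      intro g hg
      have hg' : twistMap Complex.I A.Γ g ∈ A.twist.alg := by
        refine ⟨klein A.Γ (twistMap Complex.I A.Γ g), ?_, klein_klein A.Γ_mul_Γ _⟩
        rw [klein_twistMap A.Γ_mul_Γ]
        exact add_mem (SMulMemClass.smul_mem _ hg)
          (SMulMemClass.smul_mem _ (A.stable_commutant hg))
      have h := VonNeumannAlgebra.mem_commutant_iff.mp hx _ hg'
      have h' : A.etaStarAlgEquiv (g * A.etaStarAlgEquiv.symm x) =
          A.etaStarAlgEquiv (A.etaStarAlgEquiv.symm x * g) := by
        rw [map_mul, map_mul, StarAlgEquiv.apply_symm_apply]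
        exact h
      exact A.etaStarAlgEquiv.injective h'
    have h := hcomb ((1 + Complex.I) / 2) ((1 - Complex.I) / 2) _ hz
    rwa [← klein_twistMap A.Γ_mul_Γ, twistMap_twistMap A.Γ_mul_Γ (by simp)] at h
  · intro hx
    have h := hη (hcomb ((1 + -Complex.I) / 2) ((1 - -Complex.I) / 2) _ hx)
    rwa [← twistMap_klein A.Γ_mul_Γ, klein_klein A.Γ_mul_Γ,
      twistMap_twistMap A.Γ_mul_Γ (by simp)] at h

theorem SpatialGradedVN.klein_mem_twist_commutant (A : SpatialGradedVN H) {x : H →L[ℂ] H}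
    (hx : x ∈ A.alg) : A.κ x ∈ A.twist.alg.commutant := by
  rwa [A.mem_twist_commutant_iff, klein_klein A.Γ_mul_Γ]

theorem SpatialGradedVN.twist_twist_alg (A : SpatialGradedVN H) : A.twist.twist.alg = A.alg := by
  ext x
  constructor
  · rintro ⟨y, hy, rfl⟩
    exact A.mem_twist_commutant_iff.mp hy
  · intro hx
    exact ⟨A.κ x, A.klein_mem_twist_commutant hx, klein_klein A.Γ_mul_Γ x⟩

/-- By uniqueness it suffices to test `κ(Ψ(a))` against `b = κ(y)`. There `ω_klein_mul_klein` turns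
the claim into the relation defining `Ψ'` at `y` and `γ(a)`. -/
theorem twistedDual_twistedDual (heven : IsEven A B Ψ) (hd : HasDual A B Ψ)
    (hB : B.twist.IsCyclic) (hd' : HasDual B.twist A.twist (twistedDual A B Ψ))
    (a : H →L[ℂ] H) (ha : a ∈ A.alg) (ha' : a ∈ A.twist.twist.alg) :
    (twistedDual B.twist A.twist (twistedDual A B Ψ) ⟨a, ha'⟩ : K →L[ℂ] K) = Ψ ⟨a, ha⟩ := by
  suffices h : (dual B.twist A.twist (twistedDual A B Ψ)
      ⟨A.κ a, A.klein_mem_twist_commutant ha⟩ : K →L[ℂ] K) =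
      B.κ (Ψ ⟨a, ha⟩) by
    change B.κ (dual B.twist A.twist (twistedDual A B Ψ) ⟨A.κ a, _⟩) = _
    rw [h, klein_klein B.Γ_mul_Γ]
  refine SpatialGradedVN.commutant_ext hB (Subtype.prop _)
    (B.klein_mem_twist_commutant (Ψ ⟨a, ha⟩).2) fun b => ?_
  rw [hd'.1]
  let y : B.alg.commutant := ⟨B.κ b, B.κ_mem_commutant b.2⟩
  have hb : (b : K →L[ℂ] K) = B.κ y := (klein_klein B.Γ_mul_Γ _).symm
  change A.ω (A.κ a * A.κ (dual A B Ψ y)) = B.ω (B.κ (Ψ ⟨a, ha⟩) * b)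
  rw [hb, A.ω_klein_mul_klein, B.ω_klein_mul_klein,
    VonNeumannAlgebra.mem_commutant_iff.mp (dual A B Ψ y).2 _ (A.stable a ha),
    VonNeumannAlgebra.mem_commutant_iff.mp y.2 _ (B.stable _ (Ψ ⟨a, ha⟩).2)]
  have h := hd.1 y (A.γ ⟨a, ha⟩)
  rw [heven] at h
  exact h

end Bidual

end TwistedDuality

open TwistedDuality in
theorem mainTheorem2 {H K : Type*}
    [NormedAddCommGroup H] [InnerProductSpace ℂ H] [CompleteSpace H]
    [NormedAddCommGroup K] [InnerProductSpace ℂ K] [CompleteSpace K]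
    (A : GradedVN H) (B : GradedVN K) (Ψ : A.alg →ₗ[ℂ] B.alg)
    (hpos : IsPositiveMap Ψ)
    (heven : IsEven A.toSpatial B.toSpatial Ψ)
    (hstate : PreservesState A.toSpatial B.toSpatial Ψ) :
    HasDual A.toSpatial B.toSpatial Ψ ∧
    IsPositiveMap (twistedDual A.toSpatial B.toSpatial Ψ) ∧
    IsEven B.toSpatial.twist A.toSpatial.twist (twistedDual A.toSpatial B.toSpatial Ψ) ∧
    (∃ Φ : B.toSpatial.twist.alg →L[ℂ] A.toSpatial.twist.alg,
      (Φ : B.toSpatial.twist.alg →ₗ[ℂ] A.toSpatial.twist.alg) =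
        twistedDual A.toSpatial B.toSpatial Ψ ∧ ‖Φ‖ = 1) ∧
    (∀ b : B.toSpatial.twist.alg,
      ∃ hb : B.toSpatial.η.symm b ∈ B.alg.commutant,
        (twistedDual A.toSpatial B.toSpatial Ψ b : H →L[ℂ] H) =
          A.toSpatial.η (dual A.toSpatial B.toSpatial Ψ ⟨B.toSpatial.η.symm b, hb⟩)) ∧
    (∀ b : B.toSpatial.twist.alg,
      ∃ hb : B.toSpatial.η b ∈ B.alg.commutant,
        (twistedDual A.toSpatial B.toSpatial Ψ b : H →L[ℂ] H) =
          A.toSpatial.η.symm (dual A.toSpatial B.toSpatial Ψ ⟨B.toSpatial.η b, hb⟩)) ∧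
    (∀ n : ℕ, IsNPositive n Ψ → IsNPositive n (twistedDual A.toSpatial B.toSpatial Ψ)) ∧
    (IsCompletelyPositive Ψ → IsCompletelyPositive (twistedDual A.toSpatial B.toSpatial Ψ)) ∧
    (Ψ 1 = 1 → A.toSpatial.IsSeparating → B.toSpatial.IsSeparating →
      A.toSpatial.twist.IsCyclic ∧ B.toSpatial.twist.IsCyclic ∧
      PreservesState B.toSpatial.twist A.toSpatial.twist
        (twistedDual A.toSpatial B.toSpatial Ψ) ∧
      HasDual B.toSpatial.twist A.toSpatial.twist (twistedDual A.toSpatial B.toSpatial Ψ) ∧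
      A.toSpatial.twist.twist.alg = A.alg ∧ B.toSpatial.twist.twist.alg = B.alg ∧
      ∀ (a : H →L[ℂ] H) (ha : a ∈ A.alg) (ha' : a ∈ A.toSpatial.twist.twist.alg),
        (twistedDual B.toSpatial.twist A.toSpatial.twist
          (twistedDual A.toSpatial B.toSpatial Ψ) ⟨a, ha'⟩ : K →L[ℂ] K) = Ψ ⟨a, ha⟩) := by
  have hA : A.toSpatial.IsCyclic := A.cyclic
  have hd : HasDual A.toSpatial B.toSpatial Ψ := hasDual hA hpos hstate
  have : Nontrivial H := nontrivial_of_ne A.ξ 0 (norm_ne_zero_iff.mp (by simp [A.norm_ξ]))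
  have : Nontrivial K := nontrivial_of_ne B.ξ 0 (norm_ne_zero_iff.mp (by simp [B.norm_ξ]))
  refine ⟨hd, twistedDual_isPositiveMap hA hpos heven hd, twistedDual_isEven hA heven hd,
    exists_continuous_twistedDual hA hpos heven hstate hd, twistedDual_eq_eta hA heven hd,
    twistedDual_eq_eta_symm hA heven hd, fun n hn => twistedDual_isNPositive hA heven hd hn,
    fun h n => twistedDual_isNPositive hA heven hd (h n), fun hone hsA hsB => ?_⟩
  have hB' : B.toSpatial.twist.IsCyclic := SpatialGradedVN.twist_isCyclic hsB
  have hstate' := twistedDual_preservesState hd hone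
  have hd' := hasDual hB' (twistedDual_isPositiveMap hA hpos heven hd) hstate'
  exact ⟨SpatialGradedVN.twist_isCyclic hsA, hB', hstate', hd', SpatialGradedVN.twist_twist_alg _,
    SpatialGradedVN.twist_twist_alg _, twistedDual_twistedDual heven hd hB' hd'⟩
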